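/- Let $N\ge 1$ and $k\ge 12$ be integers, and let $$f(z)=q^N+\sum_{n>N}c(n)q^n,\qquad q=e^{2\pi i z},$$ be a cusp form of weight $k$ on $\mathrm{SL}_2(\mathbb Z)$ with real Fourier coefficients, normalized as shown (so $c(N)=1$). Let $C_f$ be a real constant (for example the least one) such that $$|c(n)|\le C_f\,\sigma_0(n)\,n^{\frac{k-1}{2}}\qquad\text{for all } n\ge N,$$ where $\sigma_0(n)$ is the number of divisors of $n$. Suppose that $$\frac{4e^{2\pi}C_f}{(N+1)^{k/4}}+\frac{4e^{2\pi}C_f(2\pi)^{\lfloor k/4\rfloor}\left[\sqrt{k}\,\log(2k)+1\right]}{\lfloor k/4\rfloor!}+\frac{e^{2\pi N}(2\pi N)^{\lfloor k/4\rfloor}}{N^{k-1}\,\lfloor k/4\rfloor!}<\frac{1}{N^{k-1}}\left(e^{-2\pi N}-\frac{(2\pi N)^{k/2}}{(k/2)!}e^{2\pi N}\right),$$ and that $m=\frac k2-1$ satisfies either $m\ge 210$ and $N\le\frac14\log m$, or $m\ge 20$ and $N=1$. (The weight $k$ is even because $f\neq 0$.) Let $\mathcal E_f(z)=\int_z^{i\infty}f(\tau)(\tau-z)^{k-2}\,d\tau$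 be the Eichler integral of $f$ for $z$ in the upper half plane, and let $r_f$ be the period polynomial of $f$, that is, the polynomial of degree at most $k-2$ with $$r_f(z)=\mathcal E_f(z)-z^{k-2}\mathcal E_f\left(-\frac1z\right)$$ for all $z$ in the upper half plane. Then $r_f$ is not the zero polynomial and all its complex zeros lie on the unit circle $|z|=1$. -/

import Mathlib

open UpperHalfPlane Polynomial
open scoped MatrixGroups

/-- The `n`-th Fourier coefficient `c(n)` of a level one cusp form `f = ∑ c(n) q ^ n`,
`q = exp (2 π i z)`. -/
noncomputable def cuspCoeff {k : ℕ} (f : CuspForm 𝒮ℒ (k : ℤ)) (n : ℕ) : ℂ :=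
  (qExpansion 1 f).coeff n

/-- The Eichler integral `∫_z^{i∞} f(τ) (τ - z) ^ (k - 2) dτ`, taken along the vertical ray
`τ = z + i t`, `t > 0` (so that `τ - z = i t` and `dτ = i dt`). -/
noncomputable def eichlerIntegral {k : ℕ} (f : CuspForm 𝒮ℒ (k : ℤ)) (z : ℍ) : ℂ :=
  ∫ t in Set.Ioi (0 : ℝ),
    f (ofComplex ((z : ℂ) + Complex.I * t)) * (Complex.I * t) ^ (k - 2) * Complex.I

/-- `P` is the period polynomial `r_f` of `f`: it has degree at most `k - 2` and
`r_f(z) = E_f(z) - z ^ (k - 2) * E_f(-1 / z)` on the upper half plane, where `E_f` is the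
Eichler integral (`ModularGroup.S • z` is `-1 / z`). -/
def IsPeriodPolynomial {k : ℕ} (f : CuspForm 𝒮ℒ (k : ℤ)) (P : ℂ[X]) : Prop :=
  P.natDegree ≤ k - 2 ∧
    ∀ z : ℍ, P.eval (z : ℂ) =
      eichlerIntegral f z - (z : ℂ) ^ (k - 2) * eichlerIntegral f (ModularGroup.S • z)

/-- There is at most one period polynomial. -/
theorem IsPeriodPolynomial.unique {k : ℕ} {f : CuspForm 𝒮ℒ (k : ℤ)} {P Q : ℂ[X]}
    (hP : IsPeriodPolynomial f P) (hQ : IsPeriodPolynomial f Q) : P = Q := by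
  refine Polynomial.eq_of_infinite_eval_eq P Q (Set.Infinite.mono
    (s := Set.range ((↑) : ℍ → ℂ)) ?_ ?_)
  · rintro _ ⟨z, rfl⟩
    exact (hP.2 z).trans (hQ.2 z).symm
  · exact Set.infinite_range_of_injective fun _ _ h => UpperHalfPlane.ext h

/-- A nonzero polynomial all of whose zeros lie on the unit circle. -/
def IsUnimodular (P : ℂ[X]) : Prop :=
  P ≠ 0 ∧ ∀ z : ℂ, P.IsRoot z → ‖z‖ = 1

/-- The conditions on `m` and `N` under which the reversed truncated exponential series
`z ^ m * ∑_{n ≤ m} (2 π N / z) ^ n / n!` is considered. -/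
def TruncExpCriteria (m N : ℕ) : Prop :=
  (210 ≤ m ∧ 1 ≤ N ∧ (N : ℝ) ≤ 1 / 4 * Real.log m) ∨ (20 ≤ m ∧ N = 1)

/-! Write `k = 2m + 2`. On the imaginary axis the inversion `t ↦ 1/t` glues the two Eichler
integrals into `∫_0^∞`, so `r_f(z)` is a unit times `∑ a_j (iz)^j`, where `a_j` is `(2m choose j)`
times a moment of `f`. The identity theorem carries this to the upper half plane. The `a_j` are real
and satisfy `a_{2m-j} = i^k a_j`.

Such a self-inversive polynomial is `A(x) + ε x^m B(x)`, where `A` is its first half (with half of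
the middle term) and `|A| = |B|` on the unit circle. If `A` has no zero in the closed disc, the
maximum principle for `B/A` excludes zeros inside, and the symmetry excludes those outside
(`norm_eq_one_of_sum_eq_zero`).

It remains to see that `A ≠ 0` (`halfSum_periodCoeff_ne_zero`). Up to a common factor, `a_j` is
`(2π)^j/j! · ∑ c(n) n^{-(2m+1-j)}`. The term `n = N` alone turns `A` into a multiple of the
truncated exponential of `2πNx`, whose lower bound is the right side of the numerical hypothesis.
The three summands on the left bound the errors: the terms `n > N` for `j < ⌊k/4⌋`, the coefficients
`a_j` with `j ≥ ⌊k/4⌋`, and the exponential terms with `j ≥ ⌊k/4⌋`. -/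

/-! ### Elementary estimates: divisors, power sums, exponential tails. -/

/-- The number of divisors of `n` is at most `2 √n`. -/
theorem sigma_zero_le_two_mul_sqrt (n : ℕ) :
    (ArithmeticFunction.sigma 0 n : ℝ) ≤ 2 * Real.sqrt n := by
  rcases Nat.eq_zero_or_pos n with rfl | hn
  · simp
  rw [ArithmeticFunction.sigma_zero_apply]
  have hsub : n.divisors ⊆ (Finset.Icc 1 n.sqrt) ∪ (Finset.Icc 1 n.sqrt).image (fun d => n / d) := by
    intro d hd
    have hdn := Nat.dvd_of_mem_divisors hd
    have hd0 : 0 < d := Nat.pos_of_mem_divisors hd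
    rw [Finset.mem_union, Finset.mem_image]
    by_cases h : d ≤ n.sqrt
    · exact Or.inl (Finset.mem_Icc.2 ⟨hd0, h⟩)
    · refine Or.inr ⟨n / d, Finset.mem_Icc.2
        ⟨Nat.div_pos (Nat.le_of_dvd hn hdn) hd0, ?_⟩, Nat.div_div_self hdn hn.ne'⟩
      by_contra h'
      push Not at h h'
      have h1 := Nat.sqrt_lt'.1 h
      have h2 := Nat.sqrt_lt'.1 h'
      have h3 := Nat.div_mul_cancel hdn
      nlinarith
  have hcard : n.divisors.card ≤ 2 * n.sqrt := by
    refine (Finset.card_le_card hsub).trans ((Finset.card_union_le _ _).trans ?_)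
    have := Finset.card_image_le (s := Finset.Icc 1 n.sqrt) (f := fun d => n / d)
    simp only [Nat.card_Icc] at this ⊢
    omega
  calc (n.divisors.card : ℝ) ≤ ((2 * n.sqrt : ℕ) : ℝ) := by exact_mod_cast hcard
    _ = 2 * (n.sqrt : ℝ) := by push_cast; ring
    _ ≤ 2 * Real.sqrt n := by gcongr; exact Real.nat_sqrt_le_real_sqrt

/-- A telescoping bound for `1 / (x + 1) ^ (q + 1)`. -/
theorem mul_one_div_pow_le_sub {x : ℝ} (hx : 0 < x) (q : ℕ) :
    (q : ℝ) * (1 / (x + 1) ^ (q + 1)) ≤ 1 / x ^ q - 1 / (x + 1) ^ q := by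
  have hx' : 0 < 1 / x := by positivity
  have hb := one_add_mul_le_pow (a := 1 / x) (by linarith) q
  have h1 : (1 + 1 / x) ^ q = (x + 1) ^ q / x ^ q := by
    rw [← div_pow]; congr 1; field_simp
  rw [h1] at hb
  have h2 : (q : ℝ) / (x + 1) ≤ q * (1 / x) := by
    rw [mul_one_div]; gcongr; linarith
  have h3 : 1 / x ^ q - 1 / (x + 1) ^ q = ((x + 1) ^ q / x ^ q - 1) * (1 / (x + 1) ^ q) := by
    field_simp
  rw [h3, pow_succ]
  have h4 : (q : ℝ) * (1 / ((x + 1) ^ q * (x + 1))) = (q / (x + 1)) * (1 / (x + 1) ^ q) := by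
    field_simp
  rw [h4]
  gcongr
  linarith

/-- `∑_{n ≥ M} n ^ (-p) ≤ 2 M ^ (-p)` as soon as `M ≤ p - 1`. -/
theorem tsum_one_div_pow_le (M p : ℕ) (hM : 1 ≤ M) (hp : M + 1 ≤ p) :
    ∑' n : ℕ, 1 / ((n + M : ℕ) : ℝ) ^ p ≤ 2 * (1 / (M : ℝ) ^ p) := by
  obtain ⟨q, rfl⟩ : ∃ q, p = q + 1 := ⟨p - 1, by omega⟩
  have hM' : (0 : ℝ) < M := by exact_mod_cast hM
  have hq : (M : ℝ) ≤ q := by exact_mod_cast (by omega : M ≤ q)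
  refine Real.tsum_le_of_sum_range_le (fun n => by positivity) fun n => ?_
  have key : ∀ n : ℕ, ∑ i ∈ Finset.range n, 1 / ((i + 1 + M : ℕ) : ℝ) ^ (q + 1) ≤
      (1 / q) * (1 / (M : ℝ) ^ q - 1 / ((n + M : ℕ) : ℝ) ^ q) := by
    intro n
    induction n with
    | zero => simp
    | succ n ih =>
      rw [Finset.sum_range_succ]
      have h := mul_one_div_pow_le_sub (x := ((n + M : ℕ) : ℝ)) (by positivity) q
      have hq0 : (0 : ℝ) < q := by linarith
      have h' : 1 / ((n + 1 + M : ℕ) : ℝ) ^ (q + 1) ≤ (1 / q) *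
          (1 / ((n + M : ℕ) : ℝ) ^ q - 1 / ((n + 1 + M : ℕ) : ℝ) ^ q) := by
        rw [one_div_mul_eq_div, le_div_iff₀ hq0, mul_comm]
        rwa [show ((n + 1 + M : ℕ) : ℝ) = ((n + M : ℕ) : ℝ) + 1 by push_cast; ring]
      linarith
  have hq0 : (0 : ℝ) < q := by linarith
  -- As `M ≤ q`, the telescoped tail `M ^ (-q) / q` is no larger than the leading term; hence the
  -- factor `2`.
  have key' : ∑ i ∈ Finset.range n, 1 / ((i + 1 + M : ℕ) : ℝ) ^ (q + 1) ≤ 1 / (M : ℝ) ^ (q + 1) := by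
    refine (key n).trans ?_
    calc (1 / (q : ℝ)) * (1 / (M : ℝ) ^ q - 1 / ((n + M : ℕ) : ℝ) ^ q)
        ≤ (1 / (M : ℝ)) * (1 / (M : ℝ) ^ q) := by
          have h1 : 0 < 1 / ((n + M : ℕ) : ℝ) ^ q := by positivity
          have h2 : 0 < 1 / (M : ℝ) ^ q := by positivity
          have h3 : 1 / (q : ℝ) ≤ 1 / M := by gcongr
          have h4 : 0 < 1 / (q : ℝ) := by positivity
          nlinarith
      _ = _ := by rw [pow_succ]; field_simp
  calc ∑ i ∈ Finset.range n, 1 / ((i + M : ℕ) : ℝ) ^ (q + 1)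
      ≤ ∑ i ∈ Finset.range (n + 1), 1 / ((i + M : ℕ) : ℝ) ^ (q + 1) :=
        Finset.sum_le_sum_of_subset_of_nonneg (Finset.range_mono (Nat.le_succ n))
          fun _ _ _ => by positivity
    _ ≤ _ := by rw [Finset.sum_range_succ']; simp only [zero_add]; linarith

/-- Since `J! (j - J)!` divides `j!`, every late Taylor term splits off `x ^ J / J!`, the factor
occurring in the numerical hypothesis with `J = ⌊k/4⌋`. -/
theorem pow_div_factorial_le {x : ℝ} (hx : 0 ≤ x) {J j : ℕ} (h : J ≤ j) :
    x ^ j / j.factorial ≤ x ^ J / J.factorial * (x ^ (j - J) / (j - J).factorial) := by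
  obtain ⟨i, rfl⟩ := Nat.exists_eq_add_of_le h
  rw [Nat.add_sub_cancel_left, div_mul_div_comm, ← pow_add]
  gcongr
  exact_mod_cast Nat.le_of_dvd (Nat.factorial_pos _) (Nat.factorial_mul_factorial_dvd_factorial_add J i)

theorem sum_Ico_pow_div_factorial_le {x : ℝ} (hx : 0 ≤ x) (J n : ℕ) :
    ∑ j ∈ Finset.Ico J n, x ^ j / j.factorial ≤ x ^ J / J.factorial * Real.exp x := by
  calc ∑ j ∈ Finset.Ico J n, x ^ j / j.factorial
      ≤ ∑ j ∈ Finset.Ico J n, x ^ J / J.factorial * (x ^ (j - J) / (j - J).factorial) :=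
        Finset.sum_le_sum fun j hj => pow_div_factorial_le hx (Finset.mem_Ico.1 hj).1
    _ = x ^ J / J.factorial * ∑ i ∈ Finset.range (n - J), x ^ i / i.factorial := by
        rw [← Finset.mul_sum, Finset.sum_Ico_eq_sum_range]; simp
    _ ≤ _ := by gcongr; exact Real.sum_le_exp_of_nonneg hx _

theorem exp_sub_sum_range_le {x : ℝ} (hx : 0 ≤ x) (n : ℕ) :
    Real.exp x - ∑ j ∈ Finset.range n, x ^ j / j.factorial ≤ x ^ n / n.factorial * Real.exp x := by
  have hlim := (NormedSpace.expSeries_div_hasSum_exp (𝔸 := ℝ) x).tendsto_sum_nat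
  rw [← Real.exp_eq_exp_ℝ] at hlim
  rw [sub_le_iff_le_add]
  refine le_of_tendsto hlim (Filter.eventually_atTop.2 ⟨n, fun l hl => ?_⟩)
  rw [← Finset.sum_range_add_sum_Ico _ hl]
  linarith [sum_Ico_pow_div_factorial_le hx n l]

/-- A lower bound for truncated exponential series on a closed disc. -/
theorem norm_sum_range_pow_div_factorial_ge {R : ℝ} {w : ℂ} (hw : ‖w‖ ≤ R) (n : ℕ) :
    Real.exp (-R) - R ^ n / n.factorial * Real.exp R ≤
      ‖∑ j ∈ Finset.range n, w ^ j / j.factorial‖ := by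
  have h1 := Complex.norm_exp_sub_sum_le_exp_norm_sub_sum w n
  have h2 := exp_sub_sum_range_le (norm_nonneg w) n
  have h3 : Real.exp (-R) ≤ ‖Complex.exp w‖ := by
    rw [Complex.norm_exp, Real.exp_le_exp]
    linarith [(abs_le.1 ((Complex.abs_re_le_norm w).trans hw)).1]
  have h4 : ‖w‖ ^ n / n.factorial * Real.exp ‖w‖ ≤ R ^ n / n.factorial * Real.exp R := by
    have hR : 0 ≤ R := (norm_nonneg w).trans hw
    gcongr
  have h5 := norm_sub_norm_le (Complex.exp w) (∑ j ∈ Finset.range n, w ^ j / j.factorial)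
  linarith

/-! ### Zeros of self-inversive polynomials. -/

/-- Let `A` be an entire function with `A ≠ 0` on the closed unit disc and let `B` be entire with
`‖B‖ ≤ ‖A‖` on the unit circle; then `A + ε z ^ m B` has no zeros in the open unit disc. -/
theorem add_pow_mul_ne_zero {A B : ℂ → ℂ} (hA : Differentiable ℂ A) (hB : Differentiable ℂ B)
    (hA0 : ∀ z, ‖z‖ ≤ 1 → A z ≠ 0) (hAB : ∀ z, ‖z‖ = 1 → ‖B z‖ ≤ ‖A z‖) {m : ℕ} (hm : m ≠ 0)
    {ε : ℂ} (hε : ‖ε‖ = 1) {z : ℂ} (hz : ‖z‖ < 1) : A z + ε * (z ^ m * B z) ≠ 0 := by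
  have hmax : ‖B z / A z‖ ≤ 1 := by
    refine Complex.norm_le_of_forall_mem_frontier_norm_le (U := Metric.ball 0 1) (f := fun z => B z / A z)
      Metric.isBounded_ball ?_ (fun w hw => ?_) (subset_closure (by simpa using hz))
    · refine DifferentiableOn.diffContOnCl ?_
      rw [closure_ball _ one_ne_zero]
      exact hB.differentiableOn.div hA.differentiableOn fun w hw => hA0 w (by simpa using hw)
    · rw [frontier_ball _ one_ne_zero] at hw
      have hw : ‖w‖ = 1 := by simpa using hw
      rw [norm_div]
      exact div_le_one_of_le₀ (hAB w hw) (norm_nonneg _)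
  have hAz := norm_pos_iff.2 (hA0 z hz.le)
  rw [norm_div, div_le_one hAz] at hmax
  intro h
  have h1 : A z = -(ε * (z ^ m * B z)) := by linear_combination h
  have h2 : ‖A z‖ = ‖z‖ ^ m * ‖B z‖ := by rw [h1, norm_neg, norm_mul, hε, one_mul, norm_mul, norm_pow]
  have h3 : ‖z‖ ^ m < 1 := pow_lt_one₀ (norm_nonneg _) hz hm
  have h4 : ‖z‖ ^ m * ‖B z‖ ≤ ‖z‖ ^ m * ‖A z‖ := by gcongr
  nlinarith

/-- The first half, up to half of the middle term, of a polynomial of degree `2 m`. -/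
noncomputable def halfSum (m : ℕ) (a : ℕ → ℂ) (x : ℂ) : ℂ :=
  ∑ j ∈ Finset.range m, a j * x ^ j + a m / 2 * x ^ m

/-- The reversal of `halfSum`. -/
noncomputable def halfSumRev (m : ℕ) (a : ℕ → ℂ) (x : ℂ) : ℂ :=
  ∑ j ∈ Finset.range m, a j * x ^ (m - j) + a m / 2

theorem sum_eq_halfSum_add {m : ℕ} {a : ℕ → ℂ} {ε : ℂ}
    (hsym : ∀ j ≤ 2 * m, a (2 * m - j) = ε * a j) (x : ℂ) :
    ∑ j ∈ Finset.range (2 * m + 1), a j * x ^ j =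
      halfSum m a x + ε * (x ^ m * halfSumRev m a x) := by
  -- The symmetry at the middle index lets the two halves of the middle term be shared between both
  -- sums.
  have hmid : a m = ε * a m := by
    have := hsym m (by omega); rwa [show 2 * m - m = m by omega] at this
  have h1 : ∑ j ∈ Finset.range (2 * m + 1), a j * x ^ j =
      ∑ j ∈ Finset.range m, a j * x ^ j + (a m * x ^ m +
        ∑ j ∈ Finset.Ico (m + 1) (2 * m + 1), a j * x ^ j) := by
    rw [← Finset.sum_range_add_sum_Ico _ (show m ≤ 2 * m + 1 by omega),
      Finset.sum_eq_sum_Ico_succ_bot (show m < 2 * m + 1 by omega)]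
  have h2 : ∑ j ∈ Finset.Ico (m + 1) (2 * m + 1), a j * x ^ j =
      ∑ j ∈ Finset.range m, ε * (x ^ m * (a j * x ^ (m - j))) := by
    rw [Finset.sum_Ico_eq_sum_range, show 2 * m + 1 - (m + 1) = m by omega,
      ← Finset.sum_range_reflect]
    refine Finset.sum_congr rfl fun j hj => ?_
    have hj := Finset.mem_range.1 hj
    rw [show m + 1 + (m - 1 - j) = 2 * m - j by omega, hsym j (by omega),
      show 2 * m - j = m + (m - j) by omega, pow_add]
    ring
  rw [h1, h2, halfSum, halfSumRev, mul_add, mul_add, Finset.mul_sum, Finset.mul_sum]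
  linear_combination x ^ m / 2 * hmid

/-- A self-inversive polynomial with real coefficients whose first half has no zeros in the closed
unit disc has all its zeros on the unit circle. -/
theorem norm_eq_one_of_sum_eq_zero {m : ℕ} (hm : m ≠ 0) {a : ℕ → ℂ} {ε : ℂ} (hε : ‖ε‖ = 1)
    (hreal : ∀ j, starRingEnd ℂ (a j) = a j)
    (hsym : ∀ j ≤ 2 * m, a (2 * m - j) = ε * a j)
    (hT : ∀ x : ℂ, ‖x‖ ≤ 1 → halfSum m a x ≠ 0) {x : ℂ}
    (hx : ∑ j ∈ Finset.range (2 * m + 1), a j * x ^ j = 0) : ‖x‖ = 1 := by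
  have hin : ∀ y : ℂ, ‖y‖ < 1 → ∑ j ∈ Finset.range (2 * m + 1), a j * y ^ j ≠ 0 := by
    intro y hy
    rw [sum_eq_halfSum_add hsym]
    refine add_pow_mul_ne_zero (A := halfSum m a) (B := halfSumRev m a) ?_ ?_ hT ?_ hm hε hy
    · unfold halfSum; fun_prop
    · unfold halfSumRev; fun_prop
    · intro z hz
      have hzz : z * starRingEnd ℂ z = 1 := by
        rw [Complex.mul_conj, Complex.normSq_eq_norm_sq, hz]; simp
      -- On the circle `1/z` is the conjugate of `z`; with real coefficients, reversal is
      -- conjugation up to `z ^ m`.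
      have : halfSumRev m a z = z ^ m * starRingEnd ℂ (halfSum m a z) := by
        rw [halfSumRev, halfSum, map_add, map_sum, mul_add, Finset.mul_sum]
        congr 1
        · refine Finset.sum_congr rfl fun j hj => ?_
          rw [map_mul, map_pow, hreal, ← Nat.sub_add_cancel (Finset.mem_range.1 hj).le, pow_add,
            Nat.sub_add_cancel (Finset.mem_range.1 hj).le]
          calc a j * z ^ (m - j) = a j * z ^ (m - j) * (z * starRingEnd ℂ z) ^ j := by
                rw [hzz]; simp
            _ = _ := by rw [mul_pow]; ring
        · rw [map_mul, map_pow, map_div₀, hreal]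
          calc a m / 2 = a m / 2 * (z * starRingEnd ℂ z) ^ m := by rw [hzz]; simp
            _ = _ := by rw [mul_pow, map_ofNat]; ring
      rw [this, norm_mul, norm_pow, hz, RCLike.norm_conj]; simp
  rcases lt_trichotomy ‖x‖ 1 with h | h | h
  · exact absurd hx (hin x h)
  · exact h
  · have hx0 : x ≠ 0 := by intro h0; rw [h0, norm_zero] at h; linarith
    have hε0 : ε ≠ 0 := by intro h0; rw [h0, norm_zero] at hε; exact zero_ne_one hε
    refine absurd ?_ (hin x⁻¹ (by rw [norm_inv]; exact inv_lt_one_of_one_lt₀ h))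
    -- Self-inversiveness `P(x) = ε x^{2m} P(1/x)` moves a zero outside the disc to one inside.
    have : ∑ j ∈ Finset.range (2 * m + 1), a j * x ^ j =
        ε * x ^ (2 * m) * ∑ j ∈ Finset.range (2 * m + 1), a j * x⁻¹ ^ j := by
      rw [← Finset.sum_range_reflect, Finset.mul_sum]
      refine Finset.sum_congr rfl fun j hj => ?_
      have hj : j ≤ 2 * m := by have := Finset.mem_range.1 hj; omega
      rw [show 2 * m + 1 - 1 - j = 2 * m - j by omega, hsym j hj, inv_pow, pow_sub₀ _ hx0 hj]
      ring
    rw [this] at hx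
    exact (mul_eq_zero.1 hx).resolve_left (mul_ne_zero hε0 (pow_ne_zero _ hx0))

/-! ### Integrals over the positive half line. -/

/-- The inversion `t ↦ t⁻¹` as a change of variables on the positive half line. -/
theorem integral_Ioi_eq_integral_inv {E : Type*} [NormedAddCommGroup E] [NormedSpace ℝ E]
    (g : ℝ → E) :
    ∫ t in Set.Ioi (0 : ℝ), g t = ∫ t in Set.Ioi (0 : ℝ), (t ^ 2)⁻¹ • g t⁻¹ := by
  rw [← MeasureTheory.integral_comp_rpow_Ioi g (p := -1) (by norm_num)]
  refine MeasureTheory.setIntegral_congr_fun measurableSet_Ioi fun t ht => ?_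
  have ht : 0 < t := ht
  have h : t ^ ((-1 : ℝ) - 1) = (t ^ 2)⁻¹ := by
    rw [show (-1 : ℝ) - 1 = -((2 : ℕ) : ℝ) by norm_num, Real.rpow_neg ht.le, Real.rpow_natCast]
  simp only [h, Real.rpow_neg_one, abs_neg, abs_one, one_mul]

theorem integral_Ioi_comp_add {E : Type*} [NormedAddCommGroup E] [NormedSpace ℝ E]
    (g : ℝ → E) (y : ℝ) :
    ∫ t in Set.Ioi (0 : ℝ), g (t + y) = ∫ t in Set.Ioi y, g t := by
  rw [← MeasureTheory.integral_indicator measurableSet_Ioi,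
    ← MeasureTheory.integral_indicator measurableSet_Ioi,
    ← MeasureTheory.integral_add_right_eq_self ((Set.Ioi y).indicator g) y]
  congr 1
  ext t
  simp [Set.indicator_apply]

/-- Exchanging sum and integral in `ENNReal` avoids any integrability condition on the summed
function. -/
theorem integral_le_tsum_integral {α : Type*} [MeasurableSpace α] {μ : MeasureTheory.Measure α}
    {h : α → ℝ} {g : ℕ → α → ℝ} (hh : MeasureTheory.Integrable h μ) (hh0 : 0 ≤ᵐ[μ] h)
    (hg : ∀ n, MeasureTheory.Integrable (g n) μ) (hg0 : ∀ n, 0 ≤ᵐ[μ] g n)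
    (hle : ∀ᵐ x ∂μ, Summable (fun n => g n x) ∧ h x ≤ ∑' n, g n x)
    (hs : Summable fun n => ∫ x, g n x ∂μ) :
    ∫ x, h x ∂μ ≤ ∑' n, ∫ x, g n x ∂μ := by
  have hint0 : ∀ n, 0 ≤ ∫ x, g n x ∂μ := fun n => MeasureTheory.integral_nonneg_of_ae (hg0 n)
  rw [← ENNReal.ofReal_le_ofReal_iff (tsum_nonneg hint0),
    MeasureTheory.ofReal_integral_eq_lintegral_ofReal hh hh0, ENNReal.ofReal_tsum_of_nonneg hint0 hs]
  calc ∫⁻ x, ENNReal.ofReal (h x) ∂μ ≤ ∫⁻ x, ∑' n, ENNReal.ofReal (g n x) ∂μ := by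
        refine MeasureTheory.lintegral_mono_ae ?_
        filter_upwards [hle, MeasureTheory.ae_all_iff.2 hg0] with x hx hx0
        rw [← ENNReal.ofReal_tsum_of_nonneg hx0 hx.1]
        exact ENNReal.ofReal_le_ofReal hx.2
    _ = ∑' n, ∫⁻ x, ENNReal.ofReal (g n x) ∂μ :=
        MeasureTheory.lintegral_tsum fun n => (hg n).aestronglyMeasurable.aemeasurable.ennreal_ofReal
    _ = _ := by
        congr 1; ext n
        rw [MeasureTheory.ofReal_integral_eq_lintegral_ofReal (hg n) (hg0 n)]

theorem integral_pow_mul_exp_neg_mul (p : ℕ) {b : ℝ} (hb : 0 < b) :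
    ∫ t in Set.Ioi (0 : ℝ), t ^ p * Real.exp (-b * t) = p.factorial / b ^ (p + 1) := by
  have h := Real.integral_rpow_mul_exp_neg_mul_Ioi (a := p + 1) (by positivity) hb
  rw [Real.Gamma_nat_eq_factorial] at h
  have h2 : (1 / b) ^ ((p : ℝ) + 1) = 1 / b ^ (p + 1) := by
    rw [show (p : ℝ) + 1 = ((p + 1 : ℕ) : ℝ) by push_cast; ring, Real.rpow_natCast, one_div, inv_pow,
      one_div]
  rw [h2] at h
  rw [div_eq_mul_one_div, mul_comm, ← h]
  refine MeasureTheory.setIntegral_congr_fun measurableSet_Ioi fun t ht => ?_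
  simp [← Real.rpow_natCast]

theorem integrableOn_pow_mul_exp_neg_mul (p : ℕ) {b : ℝ} (hb : 0 < b) :
    MeasureTheory.IntegrableOn (fun t : ℝ => t ^ p * Real.exp (-b * t)) (Set.Ioi 0) := by
  by_contra h
  have h1 := integral_pow_mul_exp_neg_mul p hb
  -- A non-integrable function has integral `0` by convention, against the positive value just
  -- computed.
  rw [MeasureTheory.integral_undef h] at h1
  have : (0 : ℝ) < p.factorial / b ^ (p + 1) := by positivity
  linarith

/-! ### Cusp forms on the imaginary axis: moments and their symmetry. -/

section CuspForm

variable {k : ℕ} (f : CuspForm 𝒮ℒ (k : ℤ))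

/-- The restriction of `f` to the imaginary axis. -/
noncomputable def onImag (t : ℝ) : ℂ := f (ofComplex (Complex.I * t))

/-- The moments of `f` along the imaginary axis. -/
noncomputable def moment (p : ℕ) : ℂ := ∫ t in Set.Ioi (0 : ℝ), (t : ℂ) ^ p * onImag f t

theorem CuspForm.apply_S_smul (z : ℍ) : f (ModularGroup.S • z) = (z : ℂ) ^ k * f z := by
  have h := SlashInvariantForm.slash_action_eqn'' f
    (γ := (ModularGroup.S : GL (Fin 2) ℝ)) (MonoidHom.mem_range.2 ⟨ModularGroup.S, rfl⟩) z
  rw [ModularGroup.denom_S] at h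
  exact_mod_cast h

theorem CuspForm.hasSum_apply {w : ℂ} (hw : 0 < w.im) :
    HasSum (fun n : ℕ => cuspCoeff f n * Complex.exp (2 * Real.pi * Complex.I * n * w))
      (f (ofComplex w)) := by
  have h := ModularForm.hasSum_qExpansion f one_pos one_mem_strictPeriods_SL (ofComplex w)
  convert h using 2 with n
  rw [cuspCoeff, Function.Periodic.qParam, ← Complex.exp_nat_mul,
    ofComplex_apply_of_im_pos hw]
  congr 2
  simp; ring

theorem CuspForm.hasSum_apply_add {w : ℂ} (hw : 0 ≤ w.im) {t : ℝ} (ht : 0 < t) :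
    HasSum (fun n : ℕ => cuspCoeff f n * Complex.exp (2 * Real.pi * Complex.I * n * w) *
      (Real.exp (-(2 * Real.pi * n) * t) : ℝ)) (f (ofComplex (w + Complex.I * t))) := by
  have h := CuspForm.hasSum_apply f (w := w + Complex.I * t) (by simp; linarith)
  convert h using 2 with n
  rw [mul_assoc, Complex.ofReal_exp, ← Complex.exp_add]
  congr 2
  push_cast
  linear_combination (-2 * Real.pi * n * t : ℂ) * Complex.I_sq

/-- `S` applied twice fixes `z`, while the automorphy factors multiply to `(-1) ^ k`; odd weight
forces `f = 0`. -/
theorem even_of_cuspCoeff_ne_zero {n : ℕ} (h : cuspCoeff f n ≠ 0) : Even k := by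
  by_contra hk
  have hk : Odd k := Nat.not_even_iff_odd.1 hk
  apply h
  have hf : (f : ℍ → ℂ) = 0 := by
    ext z
    have h1 := CuspForm.apply_S_smul f (ModularGroup.S • z)
    have h2 := CuspForm.apply_S_smul f z
    have h3 : ModularGroup.S • (ModularGroup.S • z) = z := by
      ext
      rw [modular_S_smul, modular_S_smul]
      simp
    have h4 : ((ModularGroup.S • z : ℍ) : ℂ) = (-z : ℂ)⁻¹ := by rw [modular_S_smul]
    rw [h3, h2, h4, ← mul_assoc, ← mul_pow, inv_neg, neg_mul, inv_mul_cancel₀ (ne_zero z),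
      hk.neg_one_pow] at h1
    simp only [Pi.zero_apply]
    linear_combination h1 / 2
  rw [cuspCoeff, hf, qExpansion_zero]
  simp

theorem onImag_inv {t : ℝ} (ht : 0 < t) :
    onImag f t⁻¹ = Complex.I ^ k * (t : ℂ) ^ k * onImag f t := by
  have him : 0 < (Complex.I * t).im := by simpa using ht
  have him' : 0 < (Complex.I * (t⁻¹ : ℝ)).im := by simpa using ht
  have h := CuspForm.apply_S_smul f (ofComplex (Complex.I * t))
  have h2 : ModularGroup.S • ofComplex (Complex.I * t) = ofComplex (Complex.I * (t⁻¹ : ℝ)) := by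
    ext
    rw [modular_S_smul, ofComplex_apply_of_im_pos him, ofComplex_apply_of_im_pos him']
    have : (t : ℂ) ≠ 0 := by exact_mod_cast ht.ne'
    simp
    ring
  rw [h2] at h
  rw [onImag, h, ofComplex_apply_of_im_pos him, onImag, ofComplex_apply_of_im_pos him]
  simp only [mul_pow]

theorem integrableOn_pow_mul_onImag (hk : 0 < k) (p : ℕ) :
    MeasureTheory.IntegrableOn (fun t : ℝ => (t : ℂ) ^ p * onImag f t) (Set.Ioi 0) := by
  have h := ((CuspForm.isStrongFEPair (k := k) (by exact_mod_cast hk) f).hasMellin (p + 1)).1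
  refine h.congr_fun (fun t ht => ?_) measurableSet_Ioi
  simp [onImag]

/-- This is the functional equation `s ↦ k - s` at `s = q + 1`, obtained from `t ↦ 1/t`. -/
theorem moment_symm {p q : ℕ} (hpq : p + q + 2 = k) : moment f q = Complex.I ^ k * moment f p := by
  rw [moment, integral_Ioi_eq_integral_inv, moment, ← MeasureTheory.integral_const_mul]
  refine MeasureTheory.setIntegral_congr_fun measurableSet_Ioi fun t ht => ?_
  have ht0 : (t : ℂ) ≠ 0 := by exact_mod_cast (ne_of_gt ht)
  simp only [onImag_inv f ht, Complex.real_smul]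
  push_cast
  rw [inv_pow, show (t : ℂ) ^ k = t ^ p * t ^ q * t ^ 2 by rw [← pow_add, ← pow_add, hpq]]
  field_simp

theorem integral_pow_mul_norm_onImag_symm {p q : ℕ} (hpq : p + q + 2 = k) :
    ∫ t in Set.Ioi (0 : ℝ), t ^ q * ‖onImag f t‖ = ∫ t in Set.Ioi (0 : ℝ), t ^ p * ‖onImag f t‖ := by
  rw [integral_Ioi_eq_integral_inv]
  refine MeasureTheory.setIntegral_congr_fun measurableSet_Ioi fun t ht => ?_
  have ht : 0 < t := ht
  simp only [onImag_inv f ht, smul_eq_mul, norm_mul, norm_pow, Complex.norm_I, one_pow, one_mul,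
    Complex.norm_real, Real.norm_of_nonneg ht.le]
  rw [inv_pow, show t ^ k = t ^ p * t ^ q * t ^ 2 by rw [← pow_add, ← pow_add, hpq]]
  field_simp

theorem conj_onImag (hreal : ∀ n, (cuspCoeff f n).im = 0) {t : ℝ} (ht : 0 < t) :
    starRingEnd ℂ (onImag f t) = onImag f t := by
  have h := CuspForm.hasSum_apply_add f (w := 0) (by simp) ht
  rw [zero_add] at h
  change HasSum _ (onImag f t) at h
  refine HasSum.unique (h.map (starRingEnd ℂ) Complex.continuous_conj) ?_
  convert h using 2 with n
  simp only [Function.comp_apply, map_mul, Complex.conj_ofReal, mul_zero, Complex.exp_zero, map_one,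
    Complex.conj_eq_iff_im.2 (hreal n)]

theorem conj_moment (hreal : ∀ n, (cuspCoeff f n).im = 0) (p : ℕ) :
    starRingEnd ℂ (moment f p) = moment f p := by
  rw [moment, ← integral_conj]
  refine MeasureTheory.setIntegral_congr_fun measurableSet_Ioi fun t ht => ?_
  simp only [map_mul, map_pow, Complex.conj_ofReal, conj_onImag f hreal ht]

end CuspForm

/-! ### Dirichlet series for the moments. -/

section CuspForm

variable {k : ℕ} (f : CuspForm 𝒮ℒ (k : ℤ))

/-- The threshold `m + 2 ≤ p` makes the terms `O(n ^ (-2))`. It excludes the moments `m` and `m +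
1`, which need a separate argument. -/
theorem summable_norm_div_pow {c : ℕ → ℂ} {D : ℝ} {m p : ℕ}
    (hc : ∀ n, ‖c n‖ ≤ D * (n : ℝ) ^ (m + 1)) (hp : m + 2 ≤ p) :
    Summable fun n : ℕ => ‖c n‖ / (2 * Real.pi * n) ^ (p + 1) := by
  have h2 : Summable fun n : ℕ => D / (2 * Real.pi) ^ (p + 1) * (1 / (n : ℝ) ^ 2) :=
    (Real.summable_one_div_nat_pow.2 (by norm_num)).mul_left _
  refine h2.of_nonneg_of_le (fun n => by positivity) fun n => ?_
  rcases Nat.eq_zero_or_pos n with rfl | hn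
  · simp
  have hn' : (1 : ℝ) ≤ n := by exact_mod_cast hn
  obtain ⟨q, rfl⟩ := Nat.exists_eq_add_of_le hp
  have hD : 0 ≤ D := by
    have h := (norm_nonneg _).trans (hc 1)
    simpa using h
  calc ‖c n‖ / (2 * Real.pi * n) ^ (m + 2 + q + 1)
      ≤ D * (n : ℝ) ^ (m + 1) / (2 * Real.pi * n) ^ (m + 2 + q + 1) := by gcongr; exact hc n
    _ = D / (2 * Real.pi) ^ (m + 2 + q + 1) * (1 / ((n : ℝ) ^ 2 * n ^ q)) := by
        have : (n : ℝ) ^ (m + 2 + q + 1) = n ^ (m + 1) * (n ^ 2 * n ^ q) := by ring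
        rw [mul_pow, this]
        field_simp
    _ ≤ D / (2 * Real.pi) ^ (m + 2 + q + 1) * (1 / (n : ℝ) ^ 2) := by
        gcongr
        exact le_mul_of_one_le_right (by positivity) (one_le_pow₀ hn')

theorem norm_exp_two_pi_I_mul_le_one {w : ℂ} (hw : 0 ≤ w.im) (n : ℕ) :
    ‖Complex.exp (2 * Real.pi * Complex.I * n * w)‖ ≤ 1 := by
  rw [Complex.norm_exp, Real.exp_le_one_iff]
  have : (2 * Real.pi * Complex.I * n * w).re = -(2 * Real.pi * n * w.im) := by
    simp [mul_assoc, Complex.mul_re]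
  rw [this]
  have := Real.pi_pos
  have : 0 ≤ 2 * Real.pi * n * w.im := by positivity
  linarith

variable {f} {D : ℝ} {m : ℕ}

/-- Termwise Mellin transform. The shift `w = 0` yields the moments, and `w` in the upper half plane
the Eichler integral. -/
theorem hasSum_integral_pow_mul_apply (hc : ∀ n, ‖cuspCoeff f n‖ ≤ D * (n : ℝ) ^ (m + 1)) {p : ℕ}
    (hp : m + 2 ≤ p) {w : ℂ} (hw : 0 ≤ w.im) :
    HasSum (fun n : ℕ => p.factorial / (2 * Real.pi * n : ℂ) ^ (p + 1) *
        (cuspCoeff f n * Complex.exp (2 * Real.pi * Complex.I * n * w)))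
      (∫ t in Set.Ioi (0 : ℝ), (t : ℂ) ^ p * f (ofComplex (w + Complex.I * t))) := by
  have hc0 : cuspCoeff f 0 = 0 := by
    have := hc 0
    simpa using this
  have h := hasSum_mellin (s := p + 1) (p := fun n : ℕ => 2 * Real.pi * n)
    (a := fun n => cuspCoeff f n * Complex.exp (2 * Real.pi * Complex.I * n * w))
    (F := fun t => f (ofComplex (w + Complex.I * t))) ?_ ?_
    (fun t ht => CuspForm.hasSum_apply_add f hw ht) ?_
  · convert h using 2 with n
    · rw [Complex.Gamma_nat_eq_factorial]
      have : ((2 * Real.pi * n : ℝ) : ℂ) ^ ((p : ℂ) + 1) = (2 * Real.pi * n : ℂ) ^ (p + 1) := by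
        rw [← Nat.cast_succ, Complex.cpow_natCast]
        push_cast
        rfl
      rw [this]
      ring
    · refine MeasureTheory.setIntegral_congr_fun measurableSet_Ioi fun t ht => ?_
      simp
  · intro n
    rcases Nat.eq_zero_or_pos n with rfl | hn
    · left; simp [hc0]
    · right; have := Real.pi_pos; positivity
  · simp only [Complex.add_re, Complex.natCast_re, Complex.one_re]; positivity
  · refine (summable_norm_div_pow hc hp).of_nonneg_of_le (fun n => ?_) fun n => ?_
    · have := Real.pi_pos; positivity
    · have h1 : ((p : ℂ) + 1).re = ((p + 1 : ℕ) : ℝ) := by simp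
      rw [h1, Real.rpow_natCast, norm_mul]
      have := Real.pi_pos
      gcongr
      exact mul_le_of_le_one_right (norm_nonneg _) (norm_exp_two_pi_I_mul_le_one hw n)

theorem hasSum_moment (hc : ∀ n, ‖cuspCoeff f n‖ ≤ D * (n : ℝ) ^ (m + 1)) {p : ℕ}
    (hp : m + 2 ≤ p) :
    HasSum (fun n : ℕ => p.factorial / (2 * Real.pi * n : ℂ) ^ (p + 1) * cuspCoeff f n)
      (moment f p) := by
  simpa [moment, onImag] using hasSum_integral_pow_mul_apply hc hp (w := 0) (by simp)

theorem integrableOn_pow_mul_norm_onImag (f : CuspForm 𝒮ℒ (k : ℤ)) (hk : 0 < k) (p : ℕ) :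
    MeasureTheory.IntegrableOn (fun t : ℝ => t ^ p * ‖onImag f t‖) (Set.Ioi 0) := by
  refine MeasureTheory.IntegrableOn.congr_fun (integrableOn_pow_mul_onImag f hk p).norm (fun t ht => ?_) measurableSet_Ioi
  have ht : 0 < t := ht
  simp [abs_of_pos ht]

/-- Absolute moments are needed because the central moments are bounded by a pointwise comparison of
powers of `t`. -/
theorem integral_pow_mul_norm_onImag_le (hk : 0 < k)
    (hc : ∀ n, ‖cuspCoeff f n‖ ≤ D * (n : ℝ) ^ (m + 1)) {p : ℕ} (hp : m + 2 ≤ p) :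
    ∫ t in Set.Ioi (0 : ℝ), t ^ p * ‖onImag f t‖ ≤
      ∑' n : ℕ, p.factorial * (‖cuspCoeff f n‖ / (2 * Real.pi * n) ^ (p + 1)) := by
  have hpi := Real.pi_pos
  have hc0 : cuspCoeff f 0 = 0 := by
    have := hc 0
    simpa using this
  have hterm : ∀ n : ℕ, ∫ t in Set.Ioi (0 : ℝ), ‖cuspCoeff f n‖ *
      (t ^ p * Real.exp (-(2 * Real.pi * n) * t)) =
        p.factorial * (‖cuspCoeff f n‖ / (2 * Real.pi * n) ^ (p + 1)) := by
    intro n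
    rcases Nat.eq_zero_or_pos n with rfl | hn
    · simp [hc0]
    · rw [MeasureTheory.integral_const_mul, integral_pow_mul_exp_neg_mul p (by positivity)]
      ring
  simp only [← hterm]
  refine integral_le_tsum_integral (integrableOn_pow_mul_norm_onImag f hk p) ?_ ?_ ?_ ?_ ?_
  · filter_upwards [MeasureTheory.ae_restrict_mem measurableSet_Ioi] with t ht
    have ht : 0 < t := ht
    simp only [Pi.zero_apply]
    positivity
  · intro n
    rcases Nat.eq_zero_or_pos n with rfl | hn
    · simp [hc0]
    · exact (integrableOn_pow_mul_exp_neg_mul p (by positivity)).const_mul _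
  · intro n
    filter_upwards [MeasureTheory.ae_restrict_mem measurableSet_Ioi] with t ht
    have ht : 0 < t := ht
    simp only [Pi.zero_apply]
    positivity
  · filter_upwards [MeasureTheory.ae_restrict_mem measurableSet_Ioi] with t ht
    have ht : 0 < t := ht
    have h := CuspForm.hasSum_apply_add f (w := 0) (by simp) ht
    rw [zero_add] at h
    have hn : Summable fun n : ℕ => ‖cuspCoeff f n‖ * Real.exp (-(2 * Real.pi * n) * t) := by
      refine h.summable.norm.congr fun n => ?_
      simp [-Complex.ofReal_exp]
    have hle : ‖onImag f t‖ ≤ ∑' n : ℕ, ‖cuspCoeff f n‖ * Real.exp (-(2 * Real.pi * n) * t) := by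
      rw [onImag, ← h.tsum_eq]
      refine (norm_tsum_le_tsum_norm h.summable.norm).trans (le_of_eq (tsum_congr fun n => ?_))
      simp [-Complex.ofReal_exp]
    have he : ∀ n : ℕ, ‖cuspCoeff f n‖ * (t ^ p * Real.exp (-(2 * Real.pi * n) * t)) =
        t ^ p * (‖cuspCoeff f n‖ * Real.exp (-(2 * Real.pi * n) * t)) := fun n => by ring
    simp only [he]
    refine ⟨hn.mul_left _, ?_⟩
    rw [tsum_mul_left]
    gcongr
  · simp only [hterm]
    exact (summable_norm_div_pow hc hp).mul_left _

/-- Moments near the centre of symmetry are controlled by absolutely convergent ones. -/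
theorem norm_moment_le (hk : k = 2 * m + 2) {p q : ℕ} (hpq : p + q = 2 * m)
    {r : ℕ} (hrp : r ≤ p) (hqr : q ≤ r) :
    ‖moment f r‖ ≤ 2 * ∫ t in Set.Ioi (0 : ℝ), t ^ p * ‖onImag f t‖ := by
  have hk0 : 0 < k := by omega
  have hsym := integral_pow_mul_norm_onImag_symm f (p := p) (q := q) (by omega)
  calc ‖moment f r‖ ≤ ∫ t in Set.Ioi (0 : ℝ), ‖(t : ℂ) ^ r * onImag f t‖ :=
        MeasureTheory.norm_integral_le_integral_norm _
    _ ≤ ∫ t in Set.Ioi (0 : ℝ), (t ^ p * ‖onImag f t‖ + t ^ q * ‖onImag f t‖) := by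
        refine MeasureTheory.setIntegral_mono_on (integrableOn_pow_mul_onImag f hk0 r).norm
          ((integrableOn_pow_mul_norm_onImag f hk0 p).add
            (integrableOn_pow_mul_norm_onImag f hk0 q)) measurableSet_Ioi fun t ht => ?_
        have ht : 0 < t := ht
        rw [norm_mul, norm_pow, Complex.norm_real, Real.norm_of_nonneg ht.le, ← add_mul]
        gcongr
        -- `t ^ r` is dominated by `t ^ p` for `t ≥ 1` and by `t ^ q` for `t ≤ 1`.
        rcases le_total 1 t with h | h
        · exact (pow_le_pow_right₀ h hrp).trans (le_add_of_nonneg_right (by positivity))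
        · exact (pow_le_pow_of_le_one ht.le h hqr).trans (le_add_of_nonneg_left (by positivity))
    _ = _ := by
        rw [MeasureTheory.integral_add (integrableOn_pow_mul_norm_onImag f hk0 p)
            (integrableOn_pow_mul_norm_onImag f hk0 q), hsym]
        ring

end CuspForm

/-! ### The Eichler integral and the period polynomial. -/

section CuspForm

variable {k : ℕ} {f : CuspForm 𝒮ℒ (k : ℤ)} {D : ℝ} {m : ℕ}

theorem eichlerIntegral_eq (hk : k = 2 * m + 2) (f : CuspForm 𝒮ℒ (k : ℤ)) (z : ℍ) :
    eichlerIntegral f z = Complex.I ^ (2 * m + 1) *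
      ∫ t in Set.Ioi (0 : ℝ), (t : ℂ) ^ (2 * m) * f (ofComplex (z + Complex.I * t)) := by
  rw [eichlerIntegral, ← MeasureTheory.integral_const_mul]
  refine MeasureTheory.setIntegral_congr_fun measurableSet_Ioi fun t ht => ?_
  simp only [show k - 2 = 2 * m by omega]
  ring

/-- The Fourier series of the Eichler integral. -/
noncomputable def eichlerSeries (f : CuspForm 𝒮ℒ (k : ℤ)) (m : ℕ) (w : ℂ) : ℂ :=
  Complex.I ^ (2 * m + 1) * ∑' n : ℕ, ((2 * m).factorial / (2 * Real.pi * n : ℂ) ^ (2 * m + 1) *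
        (cuspCoeff f n * Complex.exp (2 * Real.pi * Complex.I * n * w)))

theorem eichlerIntegral_eq_series (hk : k = 2 * m + 2) (hm : 2 ≤ m)
    (hc : ∀ n, ‖cuspCoeff f n‖ ≤ D * (n : ℝ) ^ (m + 1)) (z : ℍ) :
    eichlerIntegral f z = eichlerSeries f m z := by
  rw [eichlerIntegral_eq hk, eichlerSeries,
    (hasSum_integral_pow_mul_apply hc (by omega) z.im_pos.le).tsum_eq]

theorem differentiableOn_eichlerSeries (hm : 2 ≤ m)
    (hc : ∀ n, ‖cuspCoeff f n‖ ≤ D * (n : ℝ) ^ (m + 1)) :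
    DifferentiableOn ℂ (eichlerSeries f m) {w | 0 < w.im} := by
  unfold eichlerSeries
  refine DifferentiableOn.const_mul ?_ _
  refine Complex.differentiableOn_tsum_of_summable_norm
    ((summable_norm_div_pow hc (p := 2 * m) (by omega)).mul_left ((2 * m).factorial : ℝ))
    (fun n => by fun_prop) isOpen_upperHalfPlaneSet fun n w hw => ?_
  have hw : 0 < w.im := hw
  have hpi := Real.pi_pos
  rw [norm_mul, norm_mul, norm_div, norm_pow, norm_mul, norm_mul, Complex.norm_natCast,
    Complex.norm_natCast, Complex.norm_real, Real.norm_of_nonneg hpi.le, Complex.norm_ofNat,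
    div_mul_eq_mul_div, ← mul_div_assoc]
  gcongr
  exact mul_le_of_le_one_right (norm_nonneg _) (norm_exp_two_pi_I_mul_le_one hw.le n)

/-- The coefficients of the period polynomial, up to powers of `I`. -/
noncomputable def periodCoeff (f : CuspForm 𝒮ℒ (k : ℤ)) (m j : ℕ) : ℂ :=
  (2 * m).choose j * moment f (2 * m - j)

theorem conj_periodCoeff (hreal : ∀ n, (cuspCoeff f n).im = 0) (j : ℕ) :
    starRingEnd ℂ (periodCoeff f m j) = periodCoeff f m j := by
  simp [periodCoeff, conj_moment f hreal]

theorem periodCoeff_symm (hk : k = 2 * m + 2) {j : ℕ} (hj : j ≤ 2 * m) :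
    periodCoeff f m (2 * m - j) = Complex.I ^ k * periodCoeff f m j := by
  rw [periodCoeff, periodCoeff, Nat.choose_symm hj, Nat.sub_sub_self hj,
    moment_symm f (p := 2 * m - j) (q := j) (by omega)]
  ring

theorem sub_pow_mul_eq_sum (t y c : ℂ) (n : ℕ) :
    (t - y) ^ n * c =
      ∑ j ∈ Finset.range (n + 1), (n.choose j * (-y) ^ j) * (t ^ (n - j) * c) := by
  rw [sub_eq_add_neg, add_comm, add_pow, Finset.sum_mul]
  exact Finset.sum_congr rfl fun j _ => by ring

theorem sum_periodCoeff (hk : k = 2 * m + 2) (y : ℂ) :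
    ∑ j ∈ Finset.range (2 * m + 1), periodCoeff f m j * (-y) ^ j =
      ∫ t in Set.Ioi (0 : ℝ), ((t : ℂ) - y) ^ (2 * m) * onImag f t := by
  simp only [sub_pow_mul_eq_sum]
  rw [MeasureTheory.integral_finsetSum _ fun j _ =>
    (integrableOn_pow_mul_onImag f (by omega) _).const_mul _]
  refine Finset.sum_congr rfl fun j _ => ?_
  rw [MeasureTheory.integral_const_mul, periodCoeff, moment]
  ring

theorem eichlerIntegral_on_imag (hk : k = 2 * m + 2) (f : CuspForm 𝒮ℒ (k : ℤ)) {y : ℝ}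
    {z : ℍ} (hz : (z : ℂ) = Complex.I * y) :
    eichlerIntegral f z = Complex.I ^ (2 * m + 1) *
      ∫ t in Set.Ioi y, ((t : ℂ) - y) ^ (2 * m) * onImag f t := by
  rw [eichlerIntegral_eq hk, ← integral_Ioi_comp_add _ y]
  congr 1
  refine MeasureTheory.setIntegral_congr_fun measurableSet_Ioi fun t ht => ?_
  simp only [onImag, hz]
  push_cast
  rw [add_sub_cancel_right, mul_add, add_comm (Complex.I * (t : ℂ))]

/-- Inversion sends the ray above `i/y` to the segment below `iy`, the piece missing from `∫_0^∞`.
The sign is `I^{2m} I^k = I^{4m+2} = -1`. -/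
theorem integral_Ioi_inv_eq_integral_Ioo (hk : k = 2 * m + 2) {y : ℝ} (hy : 0 < y) :
    (Complex.I * y) ^ (2 * m) * ∫ t in Set.Ioi y⁻¹, ((t : ℂ) - (y⁻¹ : ℝ)) ^ (2 * m) * onImag f t =
      - ∫ t in Set.Ioo 0 y, ((t : ℂ) - y) ^ (2 * m) * onImag f t := by
  have h1 : ∀ (s : Set ℝ), MeasurableSet s → s ⊆ Set.Ioi 0 → ∀ g : ℝ → ℂ,
      ∫ t in s, g t = ∫ t in Set.Ioi (0 : ℝ), s.indicator g t := by
    intro s hs hs0 g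
    rw [MeasureTheory.setIntegral_indicator hs, Set.inter_eq_self_of_subset_right hs0]
  have hy' : 0 < y⁻¹ := inv_pos.2 hy
  rw [h1 (Set.Ioi y⁻¹) measurableSet_Ioi (fun t ht => lt_trans hy' ht),
    h1 (Set.Ioo 0 y) measurableSet_Ioo (fun t ht => ht.1), integral_Ioi_eq_integral_inv,
    ← MeasureTheory.integral_const_mul, ← MeasureTheory.integral_neg]
  refine MeasureTheory.setIntegral_congr_fun measurableSet_Ioi fun t ht => ?_
  have ht : 0 < t := ht
  by_cases hty : t < y
  · have hm1 : t⁻¹ ∈ Set.Ioi y⁻¹ := (inv_lt_inv₀ hy ht).2 hty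
    have hm2 : t ∈ Set.Ioo 0 y := ⟨ht, hty⟩
    have ht0 : (t : ℂ) ≠ 0 := by exact_mod_cast ht.ne'
    have hy0 : (y : ℂ) ≠ 0 := by exact_mod_cast hy.ne'
    simp only [Set.indicator_of_mem hm1, Set.indicator_of_mem hm2, onImag_inv f ht,
      Complex.real_smul, hk]
    push_cast
    have h2 : (t : ℂ)⁻¹ - (y : ℂ)⁻¹ = -((t - y) / (t * y)) := by field_simp; ring
    have h3 : (-((t - y : ℂ) / (t * y))) ^ (2 * m) = (t - y) ^ (2 * m) / (t * y) ^ (2 * m) := by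
      rw [(even_two_mul m).neg_pow, div_pow]
    have h4 : Complex.I ^ (2 * m) * Complex.I ^ (2 * m) = 1 := by
      rw [← pow_add, show 2 * m + 2 * m = 4 * m by ring, pow_mul, Complex.I_pow_four, one_pow]
    rw [h2, h3, mul_pow, mul_pow, pow_add Complex.I, pow_add (t : ℂ), Complex.I_sq]
    field_simp
    linear_combination (-(t - y : ℂ) ^ (2 * m) * onImag f t) * h4
  · have hm1 : t⁻¹ ∉ Set.Ioi y⁻¹ := fun h => hty ((inv_lt_inv₀ hy ht).1 h)
    have hm2 : t ∉ Set.Ioo 0 y := fun h => hty h.2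
    simp [Set.indicator_of_notMem hm1, Set.indicator_of_notMem hm2]

theorem eichlerIntegral_sub_on_imag (hk : k = 2 * m + 2) (f : CuspForm 𝒮ℒ (k : ℤ)) {y : ℝ}
    (hy : 0 < y) {z : ℍ} (hz : (z : ℂ) = Complex.I * y) :
    eichlerIntegral f z - (z : ℂ) ^ (2 * m) * eichlerIntegral f (ModularGroup.S • z) =
      Complex.I ^ (2 * m + 1) *
        ∑ j ∈ Finset.range (2 * m + 1), periodCoeff f m j * (Complex.I * z) ^ j := by
  have hy0 : (y : ℂ) ≠ 0 := by exact_mod_cast hy.ne'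
  have hSz : ((ModularGroup.S • z : ℍ) : ℂ) = Complex.I * (y⁻¹ : ℝ) := by
    rw [modular_S_smul]
    simp [hz, mul_comm]
  have hIz : Complex.I * z = -(y : ℂ) := by
    rw [hz, ← mul_assoc, Complex.I_mul_I]; ring
  have hint : MeasureTheory.IntegrableOn
      (fun t : ℝ => ((t : ℂ) - y) ^ (2 * m) * onImag f t) (Set.Ioi 0) := by
    simp only [sub_pow_mul_eq_sum]
    exact MeasureTheory.integrable_finsetSum _ fun j _ =>
      (integrableOn_pow_mul_onImag f (by omega) _).const_mul _
  rw [hIz, sum_periodCoeff hk, eichlerIntegral_on_imag hk f hz,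
    eichlerIntegral_on_imag hk f hSz, hz, mul_left_comm,
    integral_Ioi_inv_eq_integral_Ioo hk hy, ← mul_sub, sub_neg_eq_add]
  congr 1
  rw [← Set.Ioc_union_Ioi_eq_Ioi hy.le, MeasureTheory.setIntegral_union
    (Set.Ioc_disjoint_Ioi le_rfl) measurableSet_Ioi
    (hint.mono_set Set.Ioc_subset_Ioi_self) (hint.mono_set (Set.Ioi_subset_Ioi hy.le)),
    MeasureTheory.integral_Ioc_eq_integral_Ioo]
  ring

/-- The polynomial `I ^ (2 m + 1) ∑ a_j (I z) ^ j`. -/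
noncomputable def periodPolynomial (f : CuspForm 𝒮ℒ (k : ℤ)) (m : ℕ) : ℂ[X] :=
  C (Complex.I ^ (2 * m + 1)) *
    ∑ j ∈ Finset.range (2 * m + 1), C (periodCoeff f m j * Complex.I ^ j) * X ^ j

theorem eval_periodPolynomial (z : ℂ) : (periodPolynomial f m).eval z = Complex.I ^ (2 * m + 1) *
    ∑ j ∈ Finset.range (2 * m + 1), periodCoeff f m j * (Complex.I * z) ^ j := by
  simp only [periodPolynomial, eval_mul, eval_C, eval_finsetSum, eval_pow, eval_X]
  congr 1
  exact Finset.sum_congr rfl fun j _ => by ring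

/-- Both sides are holomorphic, the Eichler integral through its Fourier series, and they agree on
the imaginary axis, which accumulates at `I`. -/
theorem isPeriodPolynomial_periodPolynomial (hk : k = 2 * m + 2) (hm : 2 ≤ m)
    (hc : ∀ n, ‖cuspCoeff f n‖ ≤ D * (n : ℝ) ^ (m + 1)) :
    IsPeriodPolynomial f (periodPolynomial f m) := by
  have hk2 : k - 2 = 2 * m := by omega
  refine ⟨?_, fun z => ?_⟩
  · rw [hk2, periodPolynomial]
    refine (natDegree_C_mul_le _ _).trans (natDegree_sum_le_of_forall_le _ _ fun j hj => ?_)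
    exact (natDegree_C_mul_X_pow_le _ _).trans (by have := Finset.mem_range.1 hj; omega)
  have hUopen : IsOpen {w : ℂ | 0 < w.im} := isOpen_upperHalfPlaneSet
  have hS : ∀ z : ℍ, ((ModularGroup.S • z : ℍ) : ℂ) = (-z : ℂ)⁻¹ := fun z => by rw [modular_S_smul]
  have hE : ∀ z : ℍ, eichlerIntegral f z - (z : ℂ) ^ (2 * m) * eichlerIntegral f (ModularGroup.S • z)
      = eichlerSeries f m z - (z : ℂ) ^ (2 * m) * eichlerSeries f m (-(z : ℂ))⁻¹ := by
    intro z
    rw [eichlerIntegral_eq_series hk hm hc, eichlerIntegral_eq_series hk hm hc, hS]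
  have hd := differentiableOn_eichlerSeries hm hc
  have hmaps : Set.MapsTo (fun w : ℂ => (-w)⁻¹) {w | 0 < w.im} {w | 0 < w.im} := fun w hw =>
    (⟨w, hw⟩ : ℍ).im_inv_neg_coe_pos
  have hd2 : DifferentiableOn ℂ
      (fun w => eichlerSeries f m w - w ^ (2 * m) * eichlerSeries f m (-w)⁻¹) {w | 0 < w.im} := by
    refine hd.sub (DifferentiableOn.mul (by fun_prop) (hd.comp ?_ hmaps))
    refine DifferentiableOn.inv (by fun_prop) fun w hw h => ?_
    rw [neg_eq_zero] at h
    simp [h] at hw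
  have hp : DifferentiableOn ℂ (fun w => (periodPolynomial f m).eval w) {w | 0 < w.im} :=
    (periodPolynomial f m).differentiable.differentiableOn
  rw [hk2, hE]
  refine AnalyticOnNhd.eqOn_of_preconnected_of_frequently_eq (hp.analyticOnNhd hUopen)
    (hd2.analyticOnNhd hUopen) (convex_halfSpace_im_gt 0).isPreconnected (z₀ := Complex.I)
    (by simp) ?_ z.im_pos
  have htend : Filter.Tendsto (fun y : ℝ => Complex.I * y) (nhdsWithin 1 {1}ᶜ)
      (nhdsWithin Complex.I {Complex.I}ᶜ) := by
    refine tendsto_nhdsWithin_iff.2 ⟨?_, ?_⟩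
    · have : Continuous fun y : ℝ => Complex.I * (y : ℂ) := by fun_prop
      simpa using (this.tendsto 1).mono_left nhdsWithin_le_nhds
    · filter_upwards [self_mem_nhdsWithin] with y hy
      intro h
      have h : Complex.I * (y : ℂ) = Complex.I * 1 := by simpa using h
      exact hy (by exact_mod_cast mul_left_cancel₀ Complex.I_ne_zero h)
  refine htend.frequently (Filter.Eventually.frequently ?_)
  have hpos : ∀ᶠ y : ℝ in nhdsWithin 1 {1}ᶜ, 0 < y :=
    nhdsWithin_le_nhds (Ioi_mem_nhds one_pos)
  filter_upwards [hpos] with y hy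
  have him : 0 < (Complex.I * y).im := by simpa using hy
  have h := eichlerIntegral_sub_on_imag hk f hy (z := ⟨Complex.I * y, him⟩) rfl
  rw [hE] at h
  rw [eval_periodPolynomial]
  exact h.symm

end CuspForm

/-! ### Size of the coefficients of the period polynomial. -/

theorem norm_le_of_hasSum_of_le_div_pow {u : ℕ → ℂ} {S : ℂ} (hu : HasSum u S) {B : ℝ} {M q : ℕ}
    (hM : 1 ≤ M) (hq : M + 1 ≤ q) (hu0 : ∀ n < M, u n = 0)
    (hle : ∀ n ≥ M, ‖u n‖ ≤ B * (1 / (n : ℝ) ^ q)) : ‖S‖ ≤ B * (2 * (1 / (M : ℝ) ^ q)) := by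
  have hB : 0 ≤ B := by
    have h := (norm_nonneg _).trans (hle M le_rfl)
    have hM' : (0 : ℝ) < 1 / (M : ℝ) ^ q := by positivity
    exact nonneg_of_mul_nonneg_left h hM'
  have hu' : HasSum (fun n => u (n + M)) S := by
    rw [hasSum_nat_add_iff, Finset.sum_eq_zero fun n hn => hu0 n (Finset.mem_range.1 hn), add_zero]
    exact hu
  have hs : Summable fun n : ℕ => B * (1 / ((n + M : ℕ) : ℝ) ^ q) :=
    ((summable_nat_add_iff M).2 (Real.summable_one_div_nat_pow.2 (by omega))).mul_left B
  have h := tsum_of_norm_bounded hs.hasSum fun n => hle (n + M) (by omega)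
  rw [hu'.tsum_eq, tsum_mul_left] at h
  refine h.trans ?_
  gcongr
  exact tsum_one_div_pow_le M q hM hq

section CuspForm

variable {k : ℕ} {f : CuspForm 𝒮ℒ (k : ℤ)} {D : ℝ} {m : ℕ}

/-- The common factor of the coefficients of the period polynomial. -/
noncomputable def periodFactor (m : ℕ) : ℝ := (2 * m).factorial / (2 * Real.pi) ^ (2 * m + 1)

theorem periodFactor_pos (m : ℕ) : 0 < periodFactor m := by
  have := Real.pi_pos
  unfold periodFactor
  positivity

/-- The source of the exponential series: the binomial times the Gamma factor leaves `(2π)^j / j!`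
up to a factor independent of `j`. -/
theorem choose_mul_factorial_div (m : ℕ) {j p : ℕ} (hj : p + j = 2 * m) :
    ((2 * m).choose j : ℝ) * (p.factorial / (2 * Real.pi) ^ (p + 1)) =
      periodFactor m * ((2 * Real.pi) ^ j / j.factorial) := by
  have hpi := Real.pi_pos
  have h1 : ((2 * m).choose j : ℝ) * j.factorial * p.factorial = (2 * m).factorial := by
    have := Nat.choose_mul_factorial_mul_factorial (n := 2 * m) (k := j) (by omega)
    rw [show 2 * m - j = p by omega] at this
    exact_mod_cast this
  rw [periodFactor, ← h1, ← hj, show p + j + 1 = (p + 1) + j by ring]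
  have : (j.factorial : ℝ) ≠ 0 := by positivity
  field_simp
  ring

theorem hasSum_periodCoeff (hc : ∀ n, ‖cuspCoeff f n‖ ≤ D * (n : ℝ) ^ (m + 1)) {j : ℕ}
    (hj : j + 2 ≤ m) :
    HasSum (fun n : ℕ => ((periodFactor m * ((2 * Real.pi) ^ j / j.factorial) : ℝ) : ℂ) *
      (cuspCoeff f n / (n : ℂ) ^ (2 * m + 1 - j))) (periodCoeff f m j) := by
  have h := (hasSum_moment hc (p := 2 * m - j) (by omega)).mul_left ((2 * m).choose j : ℂ)
  rw [periodCoeff]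
  refine h.congr_fun fun n => ?_
  rw [← choose_mul_factorial_div m (show 2 * m - j + j = 2 * m by omega),
    show 2 * m + 1 - j = 2 * m - j + 1 by omega, mul_pow]
  push_cast
  ring

theorem norm_div_pow_le (hc : ∀ n, ‖cuspCoeff f n‖ ≤ D * (n : ℝ) ^ (m + 1)) {j n : ℕ}
    (hj : j ≤ m) (hn : 1 ≤ n) {A : ℝ} (hA : 0 ≤ A) :
    ‖(A : ℂ) * (cuspCoeff f n / (n : ℂ) ^ (2 * m + 1 - j))‖ ≤ A * D * (1 / (n : ℝ) ^ (m - j)) := by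
  have hn' : (0 : ℝ) < n := by exact_mod_cast hn
  rw [norm_mul, norm_div, norm_pow, Complex.norm_natCast, Complex.norm_real, Real.norm_of_nonneg hA,
    mul_assoc]
  gcongr
  rw [show 2 * m + 1 - j = (m + 1) + (m - j) by omega, pow_add, div_le_iff₀ (by positivity)]
  refine (hc n).trans (le_of_eq ?_)
  field_simp

/-- The condition `j + N + 2 ≤ m` is what `tsum_one_div_pow_le` asks of the tail from `N + 1` with
exponent `m - j`. -/
theorem norm_periodCoeff_sub_le (hc : ∀ n, ‖cuspCoeff f n‖ ≤ D * (n : ℝ) ^ (m + 1)) {N : ℕ}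
    (hvanish : ∀ n < N, cuspCoeff f n = 0) (hnorm : cuspCoeff f N = 1) {j : ℕ}
    (hj : j + N + 2 ≤ m) :
    ‖periodCoeff f m j - (periodFactor m * ((2 * Real.pi) ^ j / j.factorial) : ℝ) *
        (1 / (N : ℂ) ^ (2 * m + 1 - j))‖ ≤
      periodFactor m * ((2 * Real.pi) ^ j / j.factorial) * D *
        (2 * (1 / ((N + 1 : ℕ) : ℝ) ^ (m - j))) := by
  have hpi := Real.pi_pos
  have hA : 0 ≤ periodFactor m * ((2 * Real.pi) ^ j / j.factorial) :=
    mul_nonneg (periodFactor_pos m).le (by positivity)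
  have h := hasSum_ite_sub_hasSum (hasSum_periodCoeff hc (j := j) (by omega)) N
  rw [hnorm] at h
  refine norm_le_of_hasSum_of_le_div_pow h (by omega) (by omega) (fun n hn => ?_) fun n hn => ?_
  · split_ifs with hnN
    · rfl
    · simp [hvanish n (by omega)]
  · rw [if_neg (by omega)]
    exact norm_div_pow_le hc (by omega) (by omega) hA

theorem norm_periodCoeff_le (hc : ∀ n, ‖cuspCoeff f n‖ ≤ D * (n : ℝ) ^ (m + 1)) {j : ℕ}
    (hj : j + 2 ≤ m) :
    ‖periodCoeff f m j‖ ≤ periodFactor m * ((2 * Real.pi) ^ j / j.factorial) * (2 * D) := by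
  have hpi := Real.pi_pos
  have hA : 0 ≤ periodFactor m * ((2 * Real.pi) ^ j / j.factorial) :=
    mul_nonneg (periodFactor_pos m).le (by positivity)
  have hc0 : cuspCoeff f 0 = 0 := by simpa using hc 0
  refine (norm_le_of_hasSum_of_le_div_pow (hasSum_periodCoeff hc hj) (M := 1) (q := m - j)
    le_rfl (by omega) (fun n hn => ?_) fun n hn => norm_div_pow_le hc (by omega) hn hA).trans
      (le_of_eq ?_)
  · rw [show n = 0 by omega, hc0]; simp
  · simp; ring

/-- Comparison with the pair `m + 2`, `m - 2`, the nearest to the centre that the series bound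
reaches. The `4` is `2` from `norm_moment_le` times `2` from the sum. -/
theorem norm_moment_central_le (hk : k = 2 * m + 2) (hm : 2 ≤ m)
    (hc : ∀ n, ‖cuspCoeff f n‖ ≤ D * (n : ℝ) ^ (m + 1)) {r : ℕ} (hr1 : m ≤ r) (hr2 : r ≤ m + 2) :
    ‖moment f r‖ ≤ 4 * D * ((m + 2).factorial / (2 * Real.pi) ^ (m + 3)) := by
  have hpi := Real.pi_pos
  have h1 := norm_moment_le (f := f) hk (p := m + 2) (q := m - 2) (by omega) hr2 (by omega)
  have h2 := integral_pow_mul_norm_onImag_le (by omega) hc (p := m + 2) le_rfl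
  have hs := (summable_norm_div_pow hc (p := m + 2) le_rfl).mul_left ((m + 2).factorial : ℝ)
  have h3 : ∑' n : ℕ, ((m + 2).factorial : ℝ) *
      (‖cuspCoeff f n‖ / (2 * Real.pi * n) ^ (m + 2 + 1)) ≤
        (m + 2).factorial / (2 * Real.pi) ^ (m + 3) * D * (2 * (1 / ((1 : ℕ) : ℝ) ^ 2)) := by
    have hc0 : cuspCoeff f 0 = 0 := by simpa using hc 0
    have hsC := Complex.hasSum_ofReal.2 hs.hasSum
    have h := norm_le_of_hasSum_of_le_div_pow hsC (M := 1) (q := 2)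
      (B := (m + 2).factorial / (2 * Real.pi) ^ (m + 3) * D) le_rfl le_rfl (fun n hn => ?_)
      fun n hn => ?_
    · rw [Complex.norm_real] at h
      exact (le_abs_self _).trans h
    · rw [show n = 0 by omega, hc0]; simp
    · have hn' : (0 : ℝ) < n := by exact_mod_cast hn
      rw [Complex.norm_real, Real.norm_of_nonneg (by positivity)]
      calc ((m + 2).factorial : ℝ) * (‖cuspCoeff f n‖ / (2 * Real.pi * n) ^ (m + 2 + 1))
          ≤ (m + 2).factorial * (D * (n : ℝ) ^ (m + 1) / (2 * Real.pi * n) ^ (m + 2 + 1)) := by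
            gcongr; exact hc n
        _ = _ := by
            rw [mul_pow, show (n : ℝ) ^ (m + 2 + 1) = n ^ (m + 1) * n ^ 2 by ring]
            field_simp
  norm_num at h3
  linarith

theorem norm_periodCoeff_mid_le (hk : k = 2 * m + 2) (hm : 2 ≤ m)
    (hc : ∀ n, ‖cuspCoeff f n‖ ≤ D * (n : ℝ) ^ (m + 1)) :
    ‖periodCoeff f m m‖ ≤ periodFactor m * ((2 * Real.pi) ^ m / m.factorial) *
      (4 * D * ((m + 1) * (m + 2) / (2 * Real.pi) ^ 2)) := by
  have hpi := Real.pi_pos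
  have h := norm_moment_central_le hk hm hc (r := 2 * m - m) (by omega) (by omega)
  rw [periodCoeff, norm_mul, Complex.norm_natCast, ← choose_mul_factorial_div m (two_mul m).symm,
    mul_assoc]
  gcongr
  refine h.trans (le_of_eq ?_)
  rw [Nat.factorial_succ, Nat.factorial_succ]
  push_cast
  field_simp
  ring

theorem norm_periodCoeff_pred_mid_le {l : ℕ} (hk : k = 2 * (l + 1) + 2) (hl : 1 ≤ l)
    (hc : ∀ n, ‖cuspCoeff f n‖ ≤ D * (n : ℝ) ^ (l + 1 + 1)) :
    ‖periodCoeff f (l + 1) l‖ ≤ periodFactor (l + 1) * ((2 * Real.pi) ^ l / l.factorial) *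
      (4 * D * ((l + 3) / (2 * Real.pi))) := by
  have hpi := Real.pi_pos
  have h := norm_moment_central_le hk (by omega) hc (r := 2 * (l + 1) - l) (by omega) (by omega)
  rw [periodCoeff, norm_mul, Complex.norm_natCast,
    ← choose_mul_factorial_div (l + 1) (p := l + 2) (by ring), mul_assoc]
  gcongr
  refine h.trans (le_of_eq ?_)
  rw [show l + 1 + 2 = (l + 2) + 1 by ring, Nat.factorial_succ (l + 2)]
  push_cast
  field_simp
  ring

end CuspForm

/-! ### Nonvanishing of the half sum on the closed disc. -/

/-- The central bounds lose factors polynomial in `m`; as `a` is about `m / 2`, the factorials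
absorb them, leaving ratios at most `6` and `7`. -/
theorem central_terms_le {x : ℝ} (hx : 0 < x) {m a : ℕ} (ha : 7 ≤ a) (hma : m ≤ 2 * a + 5) :
    x ^ (a + 1) / (a + 1).factorial * (2 * ((m + 2) / x)) +
      x ^ (a + 2) / (a + 2).factorial * ((m + 1) * (m + 2) / x ^ 2) ≤ 13 * Real.exp x := by
  have hu := Real.pow_div_factorial_le_exp x hx.le a
  have hu0 : 0 ≤ x ^ a / a.factorial := by positivity
  have ha' : (7 : ℝ) ≤ a := by exact_mod_cast ha
  have hm' : (m : ℝ) ≤ 2 * a + 5 := by exact_mod_cast hma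
  have hm0 : (0 : ℝ) ≤ m := Nat.cast_nonneg m
  have h1 : x ^ (a + 1) / (a + 1).factorial * (2 * ((m + 2) / x)) =
      x ^ a / a.factorial * (2 * (m + 2) / (a + 1)) := by
    rw [Nat.factorial_succ, pow_succ]; push_cast; field_simp
  have h2 : x ^ (a + 2) / (a + 2).factorial * ((m + 1) * (m + 2) / x ^ 2) =
      x ^ a / a.factorial * ((m + 1) * (m + 2) / ((a + 1) * (a + 2))) := by
    rw [Nat.factorial_succ, Nat.factorial_succ]; push_cast; field_simp; ring
  have h3 : 2 * ((m : ℝ) + 2) / (a + 1) ≤ 6 := by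
    rw [div_le_iff₀ (by positivity)]; linarith
  have h4 : ((m : ℝ) + 1) * (m + 2) / ((a + 1) * (a + 2)) ≤ 7 := by
    rw [div_le_iff₀ (by positivity)]
    calc ((m : ℝ) + 1) * (m + 2) ≤ (2 * a + 6) * (2 * a + 7) := by
          apply mul_le_mul <;> linarith
      _ ≤ _ := by nlinarith
  rw [h1, h2, ← mul_add]
  calc x ^ a / a.factorial * (2 * ((m : ℝ) + 2) / (a + 1) + (m + 1) * (m + 2) / ((a + 1) * (a + 2)))
      ≤ x ^ a / a.factorial * 13 := by gcongr; linarith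
    _ ≤ _ := by linarith

/-- Below `J` the coefficients are compared with the model `μ`; from `J` on both are simply small.
The indices `l` and `l + 1` stand apart because their bounds differ. -/
theorem norm_halfSum_sub_le (b μ : ℕ → ℂ) {l J : ℕ} (hJ : J ≤ l) {x : ℂ} (hx : ‖x‖ ≤ 1) :
    ‖halfSum (l + 1) b x - ∑ j ∈ Finset.range (l + 2), μ j * x ^ j‖ ≤
      ∑ j ∈ Finset.range J, ‖b j - μ j‖ + (∑ j ∈ Finset.Ico J l, ‖b j‖ + ‖b l‖ + ‖b (l + 1)‖ / 2) +
        ∑ j ∈ Finset.Ico J (l + 2), ‖μ j‖ := by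
  have hle : ∀ (c : ℂ) (j : ℕ), ‖c * x ^ j‖ ≤ ‖c‖ := fun c j => by
    rw [norm_mul, norm_pow]
    exact mul_le_of_le_one_right (norm_nonneg _) (pow_le_one₀ (norm_nonneg _) hx)
  have hsum : ∀ (s : Finset ℕ) (c : ℕ → ℂ), ‖∑ j ∈ s, c j * x ^ j‖ ≤ ∑ j ∈ s, ‖c j‖ := fun s c =>
    (norm_sum_le _ _).trans (Finset.sum_le_sum fun j _ => hle _ _)
  have hsplit : halfSum (l + 1) b x - ∑ j ∈ Finset.range (l + 2), μ j * x ^ j =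
      ∑ j ∈ Finset.range J, (b j - μ j) * x ^ j + (∑ j ∈ Finset.Ico J l, b j * x ^ j + b l * x ^ l +
        b (l + 1) / 2 * x ^ (l + 1)) - ∑ j ∈ Finset.Ico J (l + 2), μ j * x ^ j := by
    rw [halfSum, Finset.sum_range_succ, ← Finset.sum_range_add_sum_Ico _ hJ,
      ← Finset.sum_range_add_sum_Ico _ (show J ≤ l + 2 by omega)]
    simp only [sub_mul, Finset.sum_sub_distrib]
    ring
  have hhalf : ‖b (l + 1) / 2 * x ^ (l + 1)‖ ≤ ‖b (l + 1)‖ / 2 := by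
    refine (hle _ _).trans (le_of_eq ?_)
    rw [norm_div, Complex.norm_ofNat]
  rw [hsplit]
  refine (norm_sub_le _ _).trans (add_le_add ((norm_add_le _ _).trans (add_le_add (hsum _ _)
    ((norm_add_le _ _).trans (add_le_add ((norm_add_le _ _).trans
      (add_le_add (hsum _ _) (hle _ _))) hhalf)))) (hsum _ _))

section CuspForm

variable {k : ℕ} {f : CuspForm 𝒮ℒ (k : ℤ)}

theorem norm_cuspCoeff_le {N : ℕ} {C : ℝ} (hN : 1 ≤ N) {m : ℕ} (hk : k = 2 * m + 2)
    (hvanish : ∀ n < N, cuspCoeff f n = 0) (hC0 : 0 ≤ C)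
    (hC : ∀ n ≥ N, ‖cuspCoeff f n‖ ≤
      C * (ArithmeticFunction.sigma 0 n : ℝ) * (n : ℝ) ^ (((k : ℝ) - 1) / 2)) (n : ℕ) :
    ‖cuspCoeff f n‖ ≤ 2 * C * (n : ℝ) ^ (m + 1) := by
  rcases lt_or_ge n N with h | h
  · rw [hvanish n h, norm_zero]; positivity
  have hn : (0 : ℝ) < n := by exact_mod_cast (by omega : 0 < n)
  have hpow : Real.sqrt n * (n : ℝ) ^ (((k : ℝ) - 1) / 2) = (n : ℝ) ^ (m + 1) := by
    rw [Real.sqrt_eq_rpow, ← Real.rpow_add hn, ← Real.rpow_natCast]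
    congr 1
    rw [hk]; push_cast; ring
  calc ‖cuspCoeff f n‖ ≤ C * (ArithmeticFunction.sigma 0 n : ℝ) * (n : ℝ) ^ (((k : ℝ) - 1) / 2) :=
        hC n h
    _ ≤ C * (2 * Real.sqrt n) * (n : ℝ) ^ (((k : ℝ) - 1) / 2) := by
        gcongr; exact sigma_zero_le_two_mul_sqrt n
    _ = 2 * C * (Real.sqrt n * (n : ℝ) ^ (((k : ℝ) - 1) / 2)) := by ring
    _ = _ := by rw [hpow]

theorem thirteen_le_sqrt_mul_log {k : ℕ} (hk : 42 ≤ k) :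
    13 ≤ Real.sqrt k * Real.log (2 * k) := by
  have hk' : (42 : ℝ) ≤ k := by exact_mod_cast hk
  have h1 : 6 ≤ Real.sqrt k := Real.le_sqrt_of_sq_le (by linarith)
  have h2 : 3 ≤ Real.log (2 * k) := by
    rw [Real.le_log_iff_exp_le (by linarith)]
    have he : Real.exp 3 = Real.exp 1 ^ 3 := by rw [← Real.exp_nat_mul]; norm_num
    have h3 : Real.exp 1 ^ 3 ≤ 3 ^ 3 := by
      gcongr
      linarith [Real.exp_one_lt_d9]
    rw [he]
    linarith
  nlinarith

/-- The contribution of the coefficients beyond a quarter of the degree. -/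
theorem outer_terms_le {C : ℝ} {l J : ℕ} (hJ : J = (l + 2) / 2) (hl : 19 ≤ l) (hk : k = 2 * l + 4)
    (hC0 : 0 ≤ C) (hc : ∀ n, ‖cuspCoeff f n‖ ≤ 2 * C * (n : ℝ) ^ (l + 1 + 1)) :
    ∑ j ∈ Finset.Ico J l, ‖periodCoeff f (l + 1) j‖ + ‖periodCoeff f (l + 1) l‖ +
        ‖periodCoeff f (l + 1) (l + 1)‖ / 2 ≤ periodFactor (l + 1) *
      (4 * Real.exp (2 * Real.pi) * C * (2 * Real.pi) ^ J
            * (Real.sqrt k * Real.log (2 * k) + 1) / (J.factorial : ℝ)) := by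
  have hpi := Real.pi_pos
  set x := 2 * Real.pi with hx
  have hx0 : 0 < x := by positivity
  have hK := periodFactor_pos (l + 1)
  set K := periodFactor (l + 1)
  -- The two central indices become `J + (a + 1)` and `J + (a + 2)`, the form of `central_terms_le`.
  obtain ⟨a, ha⟩ : ∃ a, l = J + (a + 1) := ⟨l - J - 1, by omega⟩
  have hB : ∑ j ∈ Finset.Ico J l, ‖periodCoeff f (l + 1) j‖ ≤
      K * (4 * C) * (x ^ J / J.factorial * Real.exp x) := by
    calc ∑ j ∈ Finset.Ico J l, ‖periodCoeff f (l + 1) j‖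
        ≤ ∑ j ∈ Finset.Ico J l, K * (4 * C) * (x ^ j / j.factorial) := by
          refine Finset.sum_le_sum fun j hj => ?_
          have := Finset.mem_Ico.1 hj
          refine (norm_periodCoeff_le hc (by omega)).trans (le_of_eq ?_)
          ring
      _ ≤ _ := by
          rw [← Finset.mul_sum]
          gcongr
          exact sum_Ico_pow_div_factorial_le hx0.le J l
  have h1 : ‖periodCoeff f (l + 1) l‖ ≤ K * (4 * C) * (x ^ J / J.factorial) *
      (x ^ (a + 1) / (a + 1).factorial * (2 * (((l + 1 : ℕ) + 2) / x))) := by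
    have hp := pow_div_factorial_le hx0.le (show J ≤ l by omega)
    rw [show l - J = a + 1 by omega] at hp
    calc ‖periodCoeff f (l + 1) l‖
        ≤ K * (x ^ l / l.factorial) * (4 * (2 * C) * ((l + 3) / x)) :=
          norm_periodCoeff_pred_mid_le (by omega) (by omega) hc
      _ ≤ K * (x ^ J / J.factorial * (x ^ (a + 1) / (a + 1).factorial)) *
            (4 * (2 * C) * ((l + 3) / x)) := by gcongr
      _ = _ := by push_cast; ring
  have h2 : ‖periodCoeff f (l + 1) (l + 1)‖ / 2 ≤ K * (4 * C) * (x ^ J / J.factorial) *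
      (x ^ (a + 2) / (a + 2).factorial * (((l + 1 : ℕ) + 1) * ((l + 1 : ℕ) + 2) / x ^ 2)) := by
    have hp := pow_div_factorial_le hx0.le (show J ≤ l + 1 by omega)
    rw [show l + 1 - J = a + 2 by omega] at hp
    calc ‖periodCoeff f (l + 1) (l + 1)‖ / 2
        ≤ K * (x ^ (l + 1) / (l + 1).factorial) *
            (4 * (2 * C) * (((l + 1 : ℕ) + 1) * ((l + 1 : ℕ) + 2) / x ^ 2)) / 2 := by
          gcongr
          exact norm_periodCoeff_mid_le (by omega) (by omega) hc
      _ ≤ K * (x ^ J / J.factorial * (x ^ (a + 2) / (a + 2).factorial)) *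
            (4 * (2 * C) * (((l + 1 : ℕ) + 1) * ((l + 1 : ℕ) + 2) / x ^ 2)) / 2 := by gcongr
      _ = _ := by ring
  have h3 := central_terms_le hx0 (m := l + 1) (a := a) (by omega) (by omega)
  have h4 := thirteen_le_sqrt_mul_log (show 42 ≤ k by omega)
  have hP : 0 ≤ K * (4 * C) * (x ^ J / J.factorial) := by positivity
  calc _ ≤ K * (4 * C) * (x ^ J / J.factorial) * (Real.exp x +
        (x ^ (a + 1) / (a + 1).factorial * (2 * (((l + 1 : ℕ) + 2) / x)) +
          x ^ (a + 2) / (a + 2).factorial * (((l + 1 : ℕ) + 1) * ((l + 1 : ℕ) + 2) / x ^ 2))) := by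
        linarith
    _ ≤ K * (4 * C) * (x ^ J / J.factorial) * (Real.exp x + 13 * Real.exp x) := by gcongr
    _ ≤ K * (4 * C) * (x ^ J / J.factorial) *
          (Real.exp x * (Real.sqrt k * Real.log (2 * k) + 1)) := by
        gcongr
        have := Real.exp_pos x
        nlinarith
    _ = _ := by ring

/-- The contribution of the coefficients up to a quarter of the degree. -/
theorem inner_terms_le {C : ℝ} {N l J : ℕ} (hJ : J = (l + 2) / 2) (hNJ : N + 2 ≤ J)
    (hk : k = 2 * l + 4) (hC0 : 0 ≤ C)
    (hc : ∀ n, ‖cuspCoeff f n‖ ≤ 2 * C * (n : ℝ) ^ (l + 1 + 1))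
    (hvanish : ∀ n < N, cuspCoeff f n = 0) (hnorm : cuspCoeff f N = 1) :
    ∑ j ∈ Finset.range J, ‖periodCoeff f (l + 1) j -
        (periodFactor (l + 1) * ((2 * Real.pi) ^ j / j.factorial) : ℝ) *
          (1 / (N : ℂ) ^ (2 * (l + 1) + 1 - j))‖ ≤
      periodFactor (l + 1) *
        (4 * Real.exp (2 * Real.pi) * C / ((N : ℝ) + 1) ^ ((k : ℝ) / 4)) := by
  have hpi := Real.pi_pos
  have hK := periodFactor_pos (l + 1)
  set K := periodFactor (l + 1)
  calc _ ≤ ∑ j ∈ Finset.range J, K * (4 * C / ((N : ℝ) + 1) ^ ((k : ℝ) / 4)) *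
        ((2 * Real.pi) ^ j / j.factorial) := by
        refine Finset.sum_le_sum fun j hj => ?_
        have hj := Finset.mem_range.1 hj
        refine (norm_periodCoeff_sub_le hc hvanish hnorm (by omega)).trans ?_
        -- For `j < ⌊k/4⌋` the exponent `m - j` is at least `k/4`.
        have hpow : ((N : ℝ) + 1) ^ ((k : ℝ) / 4) ≤ ((N + 1 : ℕ) : ℝ) ^ (l + 1 - j) := by
          rw [← Real.rpow_natCast]
          push_cast
          refine Real.rpow_le_rpow_of_exponent_le (by linarith [Nat.cast_nonneg (α := ℝ) N]) ?_
          rw [div_le_iff₀ (by norm_num)]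
          exact_mod_cast (by omega : k ≤ (l + 1 - j) * 4)
        calc K * ((2 * Real.pi) ^ j / j.factorial) * (2 * C) *
              (2 * (1 / ((N + 1 : ℕ) : ℝ) ^ (l + 1 - j)))
            ≤ K * ((2 * Real.pi) ^ j / j.factorial) * (2 * C) *
              (2 * (1 / ((N : ℝ) + 1) ^ ((k : ℝ) / 4))) := by gcongr
          _ = _ := by ring
    _ ≤ K * (4 * C / ((N : ℝ) + 1) ^ ((k : ℝ) / 4)) * Real.exp (2 * Real.pi) := by
        rw [← Finset.mul_sum]
        gcongr
        exact Real.sum_le_exp_of_nonneg (by positivity) _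
    _ = _ := by ring

theorem halfSum_periodCoeff_ne_zero {C : ℝ} {N l J : ℕ} (hN : 1 ≤ N) (hJ : J = (l + 2) / 2)
    (hNJ : N + 2 ≤ J) (hl : 19 ≤ l) (hk : k = 2 * l + 4) (hC0 : 0 ≤ C)
    (hc : ∀ n, ‖cuspCoeff f n‖ ≤ 2 * C * (n : ℝ) ^ (l + 1 + 1))
    (hvanish : ∀ n < N, cuspCoeff f n = 0) (hnorm : cuspCoeff f N = 1)
    (hkey :
      4 * Real.exp (2 * Real.pi) * C / ((N : ℝ) + 1) ^ ((k : ℝ) / 4)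
        + 4 * Real.exp (2 * Real.pi) * C * (2 * Real.pi) ^ J
            * (Real.sqrt k * Real.log (2 * k) + 1) / (J.factorial : ℝ)
        + Real.exp (2 * Real.pi * N) * (2 * Real.pi * N) ^ J
            / ((N : ℝ) ^ (2 * l + 3) * (J.factorial : ℝ))
      < 1 / (N : ℝ) ^ (2 * l + 3)
          * (Real.exp (-(2 * Real.pi * N))
              - (2 * Real.pi * N) ^ (l + 2) / ((l + 2).factorial : ℝ)
                  * Real.exp (2 * Real.pi * N)))
    {x : ℂ} (hx : ‖x‖ ≤ 1) : halfSum (l + 1) (periodCoeff f (l + 1)) x ≠ 0 := by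
  have hpi := Real.pi_pos
  have hK := periodFactor_pos (l + 1)
  have hN' : (0 : ℝ) < N := by exact_mod_cast hN
  have hNC : (N : ℂ) ≠ 0 := by exact_mod_cast (by omega : N ≠ 0)
  set K := periodFactor (l + 1) with hKdef
  -- The contribution of `c(N) = 1` alone; `hμ` identifies it with Taylor terms of `exp (2πNx)`.
  let μ : ℕ → ℂ := fun j => (K * ((2 * Real.pi) ^ j / j.factorial) : ℝ) *
    (1 / (N : ℂ) ^ (2 * (l + 1) + 1 - j))
  have hμ : ∀ j ≤ l + 1, ∀ y : ℂ, μ j * y ^ j =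
      (K * (1 / (N : ℝ) ^ (2 * l + 3)) : ℝ) * ((2 * Real.pi * N * y) ^ j / j.factorial) := by
    intro j hj y
    have hpow : (N : ℂ) ^ (2 * l + 3) = N ^ (2 * (l + 1) + 1 - j) * N ^ j := by
      rw [← pow_add]; congr 1; omega
    simp only [μ]
    push_cast
    rw [hpow, mul_pow, mul_pow]
    field_simp
    ring
  have hmain : ∑ j ∈ Finset.range (l + 2), μ j * x ^ j =
      (K * (1 / (N : ℝ) ^ (2 * l + 3)) : ℝ) *
        ∑ j ∈ Finset.range (l + 2), (2 * Real.pi * N * x) ^ j / j.factorial := by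
    rw [Finset.mul_sum]
    exact Finset.sum_congr rfl fun j hj => hμ j (by have := Finset.mem_range.1 hj; omega) x
  have hlow := norm_sum_range_pow_div_factorial_ge (R := 2 * Real.pi * N)
    (w := 2 * Real.pi * N * x) (by
      rw [norm_mul, norm_mul, norm_mul, Complex.norm_natCast, Complex.norm_real,
        Real.norm_of_nonneg hpi.le, Complex.norm_ofNat]
      exact mul_le_of_le_one_right (by positivity) hx) (l + 2)
  have hlow' : K * (1 / (N : ℝ) ^ (2 * l + 3) * (Real.exp (-(2 * Real.pi * N))
      - (2 * Real.pi * N) ^ (l + 2) / ((l + 2).factorial : ℝ) * Real.exp (2 * Real.pi * N))) ≤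
      ‖∑ j ∈ Finset.range (l + 2), μ j * x ^ j‖ := by
    rw [hmain, norm_mul, Complex.norm_real, Real.norm_of_nonneg (by positivity), ← mul_assoc]
    gcongr
  have htail : ∑ j ∈ Finset.Ico J (l + 2), ‖μ j‖ ≤ K * (Real.exp (2 * Real.pi * N) *
      (2 * Real.pi * N) ^ J / ((N : ℝ) ^ (2 * l + 3) * (J.factorial : ℝ))) := by
    calc ∑ j ∈ Finset.Ico J (l + 2), ‖μ j‖
        = K * (1 / (N : ℝ) ^ (2 * l + 3)) *
          ∑ j ∈ Finset.Ico J (l + 2), (2 * Real.pi * N) ^ j / j.factorial := by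
          rw [Finset.mul_sum]
          refine Finset.sum_congr rfl fun j hj => ?_
          have hj := Finset.mem_Ico.1 hj
          have h := hμ j (by omega) 1
          rw [one_pow, mul_one, mul_one] at h
          rw [h, norm_mul, Complex.norm_real, Real.norm_of_nonneg (by positivity), norm_div,
            norm_pow, norm_mul, norm_mul, Complex.norm_natCast, Complex.norm_natCast,
            Complex.norm_real, Real.norm_of_nonneg hpi.le, Complex.norm_ofNat]
      _ ≤ K * (1 / (N : ℝ) ^ (2 * l + 3)) *
          ((2 * Real.pi * N) ^ J / J.factorial * Real.exp (2 * Real.pi * N)) := by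
          gcongr
          exact sum_Ico_pow_div_factorial_le (by positivity) J (l + 2)
      _ = _ := by field_simp
  have herr := norm_halfSum_sub_le (periodCoeff f (l + 1)) μ (show J ≤ l by omega) hx
  have hin := inner_terms_le hJ hNJ hk hC0 hc hvanish hnorm
  have hout := outer_terms_le hJ hl hk hC0 hc
  have hkey' := mul_lt_mul_of_pos_left hkey hK
  rw [mul_add, mul_add] at hkey'
  -- At a zero of the half sum, the truncated exponential would be no larger than the total error,
  -- against `hkey'`.
  intro h0
  rw [h0, zero_sub, norm_neg] at herr
  linarith

end CuspForm

/-! ### Conclusion. -/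

theorem mainTheorem3 (N k : ℕ) (hN : 1 ≤ N) (hk : 12 ≤ k) (f : CuspForm 𝒮ℒ (k : ℤ))
    (hvanish : ∀ n < N, cuspCoeff f n = 0)
    (hnorm : cuspCoeff f N = 1)
    (hreal : ∀ n, (cuspCoeff f n).im = 0)
    (C : ℝ)
    (hC : ∀ n ≥ N, ‖cuspCoeff f n‖ ≤
      C * (ArithmeticFunction.sigma 0 n : ℝ) * (n : ℝ) ^ (((k : ℝ) - 1) / 2))
    (hkey :
      4 * Real.exp (2 * Real.pi) * C / ((N : ℝ) + 1) ^ ((k : ℝ) / 4)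
        + 4 * Real.exp (2 * Real.pi) * C * (2 * Real.pi) ^ (k / 4)
            * (Real.sqrt k * Real.log (2 * k) + 1) / ((k / 4).factorial : ℝ)
        + Real.exp (2 * Real.pi * N) * (2 * Real.pi * N) ^ (k / 4)
            / ((N : ℝ) ^ (k - 1) * ((k / 4).factorial : ℝ))
      < 1 / (N : ℝ) ^ (k - 1)
          * (Real.exp (-(2 * Real.pi * N))
              - (2 * Real.pi * N) ^ (k / 2) / ((k / 2).factorial : ℝ)
                  * Real.exp (2 * Real.pi * N)))
    (hcrit : TruncExpCriteria (k / 2 - 1) N) :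
    ∃ r : ℂ[X], IsPeriodPolynomial f r ∧ IsUnimodular r := by
  have heven : Even k := even_of_cuspCoeff_ne_zero f (n := N) (by rw [hnorm]; exact one_ne_zero)
  obtain ⟨l, hkl⟩ : ∃ l, k = 2 * l + 4 := by
    obtain ⟨c, hc⟩ := heven
    exact ⟨c - 2, by omega⟩
  have hm : k / 2 - 1 = l + 1 := by omega
  rw [hm] at hcrit
  -- The criterion enters through these two size conditions; in the logarithmic case `log m ≤ m`
  -- suffices.
  have hcrit' : 19 ≤ l ∧ N + 2 ≤ (l + 2) / 2 := by
    rcases hcrit with ⟨h1, -, h3⟩ | ⟨h1, rfl⟩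
    · have h4 : Real.log ((l + 1 : ℕ) : ℝ) ≤ ((l + 1 : ℕ) : ℝ) :=
        Real.log_le_self (Nat.cast_nonneg _)
      have h5 : (4 * N : ℝ) ≤ ((l + 1 : ℕ) : ℝ) := by linarith
      have h6 : 4 * N ≤ l + 1 := by exact_mod_cast h5
      omega
    · omega
  obtain ⟨hl, hNJ⟩ := hcrit'
  have hC0 : 0 ≤ C := by
    have h := hC N le_rfl
    rw [hnorm, norm_one] at h
    by_contra hneg
    push Not at hneg
    have hpos : 0 ≤ (ArithmeticFunction.sigma 0 N : ℝ) * (N : ℝ) ^ (((k : ℝ) - 1) / 2) := by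
      positivity
    nlinarith
  have hc : ∀ n, ‖cuspCoeff f n‖ ≤ 2 * C * (n : ℝ) ^ (l + 1 + 1) :=
    norm_cuspCoeff_le hN (by omega) hvanish hC0 hC
  rw [show k / 4 = (l + 2) / 2 by omega, show k / 2 = l + 2 by omega,
    show k - 1 = 2 * l + 3 by omega] at hkey
  have hT : ∀ x : ℂ, ‖x‖ ≤ 1 → halfSum (l + 1) (periodCoeff f (l + 1)) x ≠ 0 := fun x hx =>
    halfSum_periodCoeff_ne_zero hN rfl hNJ hl hkl hC0 hc hvanish hnorm hkey hx
  have hroot : ∀ z : ℂ, (periodPolynomial f (l + 1)).IsRoot z → ‖z‖ = 1 := by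
    intro z hz
    rw [Polynomial.IsRoot, eval_periodPolynomial] at hz
    have hz := (mul_eq_zero.1 hz).resolve_left (pow_ne_zero _ Complex.I_ne_zero)
    have h := norm_eq_one_of_sum_eq_zero (Nat.succ_ne_zero l) (ε := Complex.I ^ k) (by simp)
      (conj_periodCoeff hreal) (fun j hj => periodCoeff_symm (by omega) hj) hT hz
    simpa using h
  refine ⟨periodPolynomial f (l + 1),
    isPeriodPolynomial_periodPolynomial (by omega) (by omega) hc, ?_, hroot⟩
  -- The zero polynomial would have `0` as a root, which `hroot` forbids.
  intro h0
  have h := hroot 0 (by rw [h0]; simp)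
  simp at h
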